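/- **Setting.** Let $A=(A_{ij})$ be an $n\times n$ generalized Cartan matrix (integers, $A_{ii}=2$, $A_{ij}\le 0$ for $i\ne j$, $A_{ij}=0\Rightarrow A_{ji}=0$) of rank $r$, and let $(H,\{\alpha_i\},\{\alpha_i^\vee\})$ be a realization of $A$: $H$ is a complex vector space of dimension $2n-r$, the $\alpha_i^\vee\in H$ and the $\alpha_i\in H^*$ ($1\le i\le n$) are linearly independent, and $\langle\alpha_j,\alpha_i^\vee\rangle=A_{ij}$. Let $T_0$ be the complex tensor algebra of $\bigoplus_i\mathbb C \hat e_i\oplus\bigoplus_i\mathbb C\hat f_i\oplus H$, let $T=\mathbb H\otimes_{\mathbb R}T_0$ with bracket $[c_1\otimes u,c_2\otimes v]=c_1c_2\otimes uv-c_2c_1\otimes vu$ and with $\mathbb C$ acting through $T_0$, and let $J$ be multiplication by $j\otimes 1$, where $j\in\mathbb H$ is a quaternion unit. Let $\hat g(A)\subset T$ be the complex Lie subalgebra generated by $\hat e_i,J\hat e_i,\hat f_i,J\hat f_i$ ($1\le i\le n$), $H$ and $JH$. It is stable under $J$. Put $\langle\alpha_i,Jh\rangle:=J\langle\alpha_i,h\rangle$.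 Let $\hat I$ be the (complex) ideal of $\hat g(A)$ generated by the following elements, for $h,h'\in H$ and $1\le i,j\le n$: $$[h,h'],\quad [h,\hat e_i]-\langle\alpha_i,h\rangle \hat e_i,\quad [h,\hat f_i]+\langle\alpha_i,h\rangle \hat f_i,\quad [\hat e_i,\hat f_j]-\delta_{ij}\alpha_i^\vee,$$ $$[h,Jh'],\quad [Jh,Jh'],\quad [Jh,\hat e_i]-\langle\alpha_i,Jh\rangle \hat e_i,\quad [h,J\hat e_i]-\langle\alpha_i,h\rangle J\hat e_i,\quad [Jh,J\hat e_i]+\langle\alpha_i,h\rangle \hat e_i,$$ $$[Jh,\hat f_i]+\langle\alpha_i,Jh\rangle \hat f_i,\quad [h,J\hat f_i]+\langle\alpha_i,h\rangle J\hat f_i,\quad [Jh,J\hat f_i]-\langle\alpha_i,h\rangle \hat f_i,$$ $$[J\hat e_i,\hat f_j]-\delta_{ij}J\alpha_i^\vee,\quad [\hat e_i,J\hat f_j]-\delta_{ij}J\alpha_i^\vee,\quad [J\hat e_i,J\hat f_j]+\delta_{ij}\alpha_i^\vee .$$ The ideal $\hat I$ is stable under $J$. The *universal Kac–Moody quaternion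 Lie algebra* is $\tilde g(A)=\hat g(A)/\hat I$; the images of $\hat e_i,\hat f_i$ and $h$ are written $e_i,f_i$ and $h$. **Theorem.** (a) As a real Lie algebra, $\tilde g(A)$ is generated by $\{e_i,Je_i,f_i,Jf_i\}_{i=1}^n\cup H\cup JH$. (b) For all $h,h'\in H$ and all $i,j$, the following hold in $\tilde g(A)$: $$[h,e_i]=\langle\alpha_i,h\rangle e_i,\quad [Jh,e_i]=\langle\alpha_i,Jh\rangle e_i,\quad [h,Je_i]=\langle\alpha_i,h\rangle Je_i,\quad [Jh,Je_i]=-\langle\alpha_i,h\rangle e_i,$$ $$[h,f_i]=-\langle\alpha_i,h\rangle f_i,\quad [Jh,f_i]=-\langle\alpha_i,Jh\rangle f_i,\quad [h,Jf_i]=-\langle\alpha_i,h\rangle Jf_i,\quad [Jh,Jf_i]=\langle\alpha_i,h\rangle f_i,$$ $$[e_i,f_j]=\delta_{ij}\alpha_i^\vee,\quad [Je_i,f_j]=[e_i,Jf_j]=\delta_{ij}J\alpha_i^\vee,\quad [Je_i,Jf_j]=-\delta_{ij}\alpha_i^\vee,$$ $$[h,h']=[h,Jh']=[Jh,Jh']=0.$$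 In particular $$[\alpha_i^\vee,e_j]=A_{ij}e_j,\quad [J\alpha_i^\vee,e_j]=[\alpha_i^\vee,Je_j]=A_{ij}Je_j,\quad [J\alpha_i^\vee,Je_j]=-A_{ij}e_j,$$ $$[\alpha_i^\vee,f_j]=-A_{ij}f_j,\quad [J\alpha_i^\vee,f_j]=[\alpha_i^\vee,Jf_j]=-A_{ij}Jf_j,\quad [J\alpha_i^\vee,Jf_j]=A_{ij}f_j.$$ (c) Let $\tilde N^-$, $\tilde N^+$ and $K$ be the complex Lie subalgebras generated by $\{f_i,Jf_i\}_i$, by $\{e_i,Je_i\}_i$ and by $H\cup JH$. The maps $h\mapsto h$ and $h\mapsto Jh$ from $H$ to $\tilde g(A)$ are injective, $K=H\oplus JH$, and $$\tilde g(A)=\tilde N^-\oplus K\oplus\tilde N^+ .$$ (d) $K$ is a maximal commutative real Lie subalgebra of $\tilde g(A)$. Let $H_r$ be a real form of $H$ (a real subspace with $H=H_r\oplus\sqrt{-1}\,H_r$) that contains all $\alpha_i^\vee$ and on which all $\alpha_i$ are real-valued. Then $H_r$ is a maximal commutative subalgebra of the real Lie subalgebra $\tilde g_r(A)$ generated by the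 $e_i$, the $f_i$ and $H_r$. Put $Q^+=\{\sum_i k_i\alpha_i: k_i\in\mathbb Z_{\ge0}\}$ and, for $\alpha\in H^*$, $\tilde g_\alpha=\{x\in\tilde g(A): [h,x]=\langle\alpha,h\rangle x\ \text{for all } h\in H_r\}$. Then $$\tilde g(A)=\Big(\bigoplus_{0\ne\alpha\in Q^+}\tilde g_{-\alpha}\Big)\oplus\tilde g_0\oplus\Big(\bigoplus_{0\ne\alpha\in Q^+}\tilde g_{\alpha}\Big),\qquad H_r\subset\tilde g_0=K,$$ every $\tilde g_\alpha$ is finite-dimensional, and $\tilde g_{\alpha}\subset\tilde N^+$, $\tilde g_{-\alpha}\subset\tilde N^-$ for $0\ne\alpha\in Q^+$. -/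

import Mathlib

open scoped TensorProduct Quaternion

noncomputable section

namespace KacMoodyQuaternion

/-- Generalized Cartan matrices. -/
structure IsGeneralizedCartan {n : ℕ} (A : Matrix (Fin n) (Fin n) ℤ) : Prop where
  diag : ∀ i, A i i = 2
  nonpos : ∀ i j, i ≠ j → A i j ≤ 0
  zero_symm : ∀ i j, A i j = 0 → A j i = 0

/-- A realization `(H, Π, Π^∨)` of an `n × n` matrix `A` of rank `r`: the complex vector space `H`
has dimension `2n - r`, the `α_i^∨ ∈ H` and the `α_i ∈ H^*` are linearly independent, and
`⟨α_j, α_i^∨⟩ = A_ij`.  (The quaternionic part `(JH, JΠ, JΠ^∨)` is determined by it: `JH` is the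
copy `J ⊗ H` of `H`, and `⟨α_j, J h⟩ = J ⟨α_j, h⟩`.) -/
structure Realization {n : ℕ} (A : Matrix (Fin n) (Fin n) ℤ)
    (H : Type*) [AddCommGroup H] [Module ℂ H] where
  finiteDimensional : FiniteDimensional ℂ H
  finrank_eq : Module.finrank ℂ H + (A.map (Int.cast : ℤ → ℂ)).rank = 2 * n
  coroot : Fin n → H
  coroot_indep : LinearIndependent ℂ coroot
  root : Fin n → Module.Dual ℂ H
  root_indep : LinearIndependent ℂ root
  pairing : ∀ i j, root j (coroot i) = (A i j : ℂ)

section Free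

variable (n : ℕ) (H : Type*) [AddCommGroup H] [Module ℂ H]

/-- The complex vector space with basis the `e_i`, the `f_i` and a basis of `H`. -/
abbrev GenSpace : Type _ := (Fin n → ℂ) × (Fin n → ℂ) × H

/-- The complex tensor algebra `T₀` on the generators. -/
def T₀ : Type _ := TensorAlgebra ℂ (GenSpace n H)

instance : Ring (T₀ n H) := inferInstanceAs (Ring (TensorAlgebra ℂ (GenSpace n H)))

instance : Algebra ℂ (T₀ n H) := inferInstanceAs (Algebra ℂ (TensorAlgebra ℂ (GenSpace n H)))

/-- The inclusion of the generators in `T₀`. -/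
def ι₀ : GenSpace n H →ₗ[ℂ] T₀ n H := TensorAlgebra.ι ℂ

/-- The quaternion tensor algebra: the quaternions tensored over `ℝ` with the complex tensor
algebra `T₀` on the generators (the complex factor is written on the left, so that `ℂ` acts through
`T₀`).  Its product is `(u ⊗ c)(v ⊗ d) = (u v) ⊗ (c d)`, so its commutator bracket is
`[u ⊗ c, v ⊗ d] = (u v) ⊗ (c d) - (v u) ⊗ (d c)`. -/
def QTensor : Type _ := T₀ n H ⊗[ℝ] ℍ[ℝ]

instance : Ring (QTensor n H) := inferInstanceAs (Ring (T₀ n H ⊗[ℝ] ℍ[ℝ]))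

instance : Algebra ℂ (QTensor n H) := inferInstanceAs (Algebra ℂ (T₀ n H ⊗[ℝ] ℍ[ℝ]))

/-- The pure tensor `u ⊗ c`. -/
def tens (u : T₀ n H) (c : ℍ[ℝ]) : QTensor n H := (u ⊗ₜ[ℝ] c : T₀ n H ⊗[ℝ] ℍ[ℝ])

/-- The commutator bracket `[x, y] = x y - y x`. -/
instance : LieRing (QTensor n H) := LieRing.ofAssociativeRing

instance : LieAlgebra ℂ (QTensor n H) := LieAlgebra.ofAssociativeAlgebra

/-- The quaternion unit `j`. -/
def quatJ : ℍ[ℝ] := ⟨0, 0, 1, 0⟩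

lemma quatJ_mul_self : quatJ * quatJ = -1 := by
  ext <;> simp [Quaternion.re_mul, Quaternion.imI_mul, Quaternion.imJ_mul, Quaternion.imK_mul] <;>
    simp [quatJ]

/-- The scalar `J = 1 ⊗ j` in the quaternion tensor algebra. -/
def qJ : QTensor n H := tens n H 1 quatJ

/-- A generator `v` seen as `v ⊗ 1`. -/
def gen (v : GenSpace n H) : QTensor n H := tens n H (ι₀ n H v) 1

/-- A generator `v` multiplied by `J`, that is `v ⊗ j`. -/
def genJ (v : GenSpace n H) : QTensor n H := tens n H (ι₀ n H v) quatJ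

/-- The free quaternion Lie algebra `ĝ = L(X, JX)`: the complex Lie subalgebra of the quaternion
tensor algebra (with the commutator bracket) generated by the set `X` of the `e_i`, the `f_i` and
the elements of `H`, together with `JX`. -/
def freeSub : LieSubalgebra ℂ (QTensor n H) :=
  LieSubalgebra.lieSpan ℂ (QTensor n H) (Set.range (gen n H) ∪ Set.range (genJ n H))

variable {n H}

lemma tens_mul (u v : T₀ n H) (c d : ℍ[ℝ]) :
    tens n H u c * tens n H v d = tens n H (u * v) (c * d) :=
  Algebra.TensorProduct.tmul_mul_tmul u v c d

lemma tens_add_left (u v : T₀ n H) (c : ℍ[ℝ]) :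
    tens n H (u + v) c = tens n H u c + tens n H v c :=
  TensorProduct.add_tmul u v c

lemma tens_smul_left (a : ℂ) (u : T₀ n H) (c : ℍ[ℝ]) :
    tens n H (a • u) c = a • tens n H u c :=
  rfl

lemma tens_neg_right (u : T₀ n H) (c : ℍ[ℝ]) : tens n H u (-c) = -tens n H u c :=
  TensorProduct.tmul_neg u c

lemma tens_one : tens n H 1 1 = 1 := rfl

lemma qJ_mul_gen (v : GenSpace n H) : qJ n H * gen n H v = genJ n H v := by
  simp [qJ, gen, genJ, tens_mul]

lemma gen_mul_qJ (v : GenSpace n H) : gen n H v * qJ n H = genJ n H v := by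
  simp [qJ, gen, genJ, tens_mul]

lemma qJ_mul_qJ : qJ n H * qJ n H = -1 := by
  rw [qJ, tens_mul, quatJ_mul_self, mul_one, tens_neg_right, tens_one]

lemma qJ_mul_genJ (v : GenSpace n H) : qJ n H * genJ n H v = -gen n H v := by
  rw [← qJ_mul_gen, ← mul_assoc, qJ_mul_qJ, neg_one_mul]

lemma gen_mem (v : GenSpace n H) : gen n H v ∈ freeSub n H :=
  LieSubalgebra.subset_lieSpan (Or.inl ⟨v, rfl⟩)

lemma genJ_mem (v : GenSpace n H) : genJ n H v ∈ freeSub n H :=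
  LieSubalgebra.subset_lieSpan (Or.inr ⟨v, rfl⟩)

/-- The elements of `ĝ` commute with the scalar `J`, and `ĝ` is stable under multiplication
by `J`. -/
lemma freeSub_qJ {x : QTensor n H} (hx : x ∈ freeSub n H) :
    Commute (qJ n H) x ∧ qJ n H * x ∈ freeSub n H := by
  let S : LieSubalgebra ℂ (QTensor n H) :=
    { carrier := {x | x ∈ freeSub n H ∧ Commute (qJ n H) x ∧ qJ n H * x ∈ freeSub n H}
      zero_mem' := ⟨zero_mem _, Commute.zero_right _, by rw [mul_zero]; exact zero_mem _⟩
      add_mem' := fun {a b} ha hb => ⟨add_mem ha.1 hb.1, ha.2.1.add_right hb.2.1, by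
        rw [mul_add]; exact add_mem ha.2.2 hb.2.2⟩
      smul_mem' := fun c a ha => ⟨(freeSub n H).smul_mem c ha.1, ha.2.1.smul_right c, by
        rw [mul_smul_comm]; exact (freeSub n H).smul_mem c ha.2.2⟩
      lie_mem' := fun {a b} ha hb => ⟨(freeSub n H).lie_mem ha.1 hb.1, by
          rw [LieRing.of_associative_ring_bracket]
          exact (ha.2.1.mul_right hb.2.1).sub_right (hb.2.1.mul_right ha.2.1), by
          have h := (freeSub n H).lie_mem ha.2.2 hb.1
          rw [LieRing.of_associative_ring_bracket] at h ⊢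
          rw [mul_sub, ← mul_assoc, ← mul_assoc, hb.2.1.eq, mul_assoc b]
          exact h⟩ }
  have hle : freeSub n H ≤ S := by
    refine LieSubalgebra.lieSpan_le.2 ?_
    rintro _ (⟨v, rfl⟩ | ⟨v, rfl⟩)
    · refine ⟨gen_mem v, ?_, ?_⟩
      · rw [commute_iff_eq, qJ_mul_gen, gen_mul_qJ]
      · rw [qJ_mul_gen]; exact genJ_mem v
    · refine ⟨genJ_mem v, ?_, ?_⟩
      · rw [← qJ_mul_gen]
        refine (Commute.refl _).mul_right ?_
        rw [commute_iff_eq, qJ_mul_gen, gen_mul_qJ]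
      · rw [qJ_mul_genJ]; exact neg_mem (gen_mem v)
  exact (hle hx).2

variable (n H) in
/-- The free quaternion Lie algebra `ĝ` as a type. -/
abbrev FreeLie : Type _ := freeSub n H

/-- The operator `J` on `ĝ`. -/
def jFree : FreeLie n H →ₗ[ℂ] FreeLie n H where
  toFun x := ⟨qJ n H * x, (freeSub_qJ x.2).2⟩
  map_add' _ _ := Subtype.ext (mul_add _ _ _)
  map_smul' c _ := Subtype.ext (mul_smul_comm c _ _)

lemma jFree_jFree (x : FreeLie n H) : jFree (jFree x) = -x := by
  apply Subtype.ext
  change qJ n H * (qJ n H * (x : QTensor n H)) = -(x : QTensor n H)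
  rw [← mul_assoc, qJ_mul_qJ, neg_one_mul]

lemma jFree_lie_left (x y : FreeLie n H) : ⁅jFree x, y⁆ = jFree ⁅x, y⁆ := by
  apply Subtype.ext
  change ⁅qJ n H * (x : QTensor n H), (y : QTensor n H)⁆ =
    qJ n H * ⁅(x : QTensor n H), (y : QTensor n H)⁆
  rw [LieRing.of_associative_ring_bracket, LieRing.of_associative_ring_bracket, mul_sub,
    ← mul_assoc, ← mul_assoc, ← mul_assoc, (freeSub_qJ y.2).1.eq]

lemma jFree_lie_right (x y : FreeLie n H) : ⁅x, jFree y⁆ = jFree ⁅x, y⁆ := by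
  rw [← lie_skew, jFree_lie_left, ← map_neg, lie_skew]

/-- The generators of `ĝ`, depending linearly on the vector. -/
def genFree : GenSpace n H →ₗ[ℂ] FreeLie n H where
  toFun v := ⟨gen n H v, gen_mem v⟩
  map_add' v w := Subtype.ext (by simp [gen, tens_add_left])
  map_smul' c v := Subtype.ext (by simp [gen, tens_smul_left])

/-- The generators `ê_i`. -/
def eFree (H : Type*) [AddCommGroup H] [Module ℂ H] (i : Fin n) : FreeLie n H :=
  genFree (Pi.single i 1, 0, 0)

/-- The generators `f̂_i`. -/
def fFree (H : Type*) [AddCommGroup H] [Module ℂ H] (i : Fin n) : FreeLie n H :=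
  genFree (0, Pi.single i 1, 0)

/-- The generators `ĥ`, for `h ∈ H`. -/
def hFree (n : ℕ) {H : Type*} [AddCommGroup H] [Module ℂ H] : H →ₗ[ℂ] FreeLie n H :=
  genFree ∘ₗ LinearMap.inr ℂ (Fin n → ℂ) ((Fin n → ℂ) × H) ∘ₗ LinearMap.inr ℂ (Fin n → ℂ) H

end Free

namespace Realization

variable {n : ℕ} {A : Matrix (Fin n) (Fin n) ℤ} {H : Type*} [AddCommGroup H] [Module ℂ H]
  (R : Realization A H)

/-- The untwisted relators. -/
inductive Relator₀ : FreeLie n H → Prop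
  | hh (h h' : H) : Relator₀ ⁅hFree n h, hFree n h'⁆
  | he (h : H) (i : Fin n) :
      Relator₀ (⁅hFree n h, eFree H i⁆ - R.root i h • eFree H i)
  | hf (h : H) (i : Fin n) :
      Relator₀ (⁅hFree n h, fFree H i⁆ + R.root i h • fFree H i)
  | ef (i j : Fin n) :
      Relator₀ (⁅eFree H i, fFree H j⁆ - if i = j then hFree n (R.coroot i) else 0)

/-- The `J`-twisted relators; the scalar `⟨α_i, J h⟩` is `J ⟨α_i, h⟩`. -/
inductive RelatorJ : FreeLie n H → Prop
  | hJh (h h' : H) : RelatorJ ⁅hFree n h, jFree (hFree n h')⁆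
  | JhJh (h h' : H) : RelatorJ ⁅jFree (hFree n h), jFree (hFree n h')⁆
  | Jhe (h : H) (i : Fin n) :
      RelatorJ (⁅jFree (hFree n h), eFree H i⁆ - jFree (R.root i h • eFree H i))
  | hJe (h : H) (i : Fin n) :
      RelatorJ (⁅hFree n h, jFree (eFree H i)⁆ - R.root i h • jFree (eFree H i))
  | JhJe (h : H) (i : Fin n) :
      RelatorJ (⁅jFree (hFree n h), jFree (eFree H i)⁆ + R.root i h • eFree H i)
  | Jhf (h : H) (i : Fin n) :
      RelatorJ (⁅jFree (hFree n h), fFree H i⁆ + jFree (R.root i h • fFree H i))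
  | hJf (h : H) (i : Fin n) :
      RelatorJ (⁅hFree n h, jFree (fFree H i)⁆ + R.root i h • jFree (fFree H i))
  | JhJf (h : H) (i : Fin n) :
      RelatorJ (⁅jFree (hFree n h), jFree (fFree H i)⁆ - R.root i h • fFree H i)
  | Jef (i j : Fin n) :
      RelatorJ (⁅jFree (eFree H i), fFree H j⁆ - if i = j then jFree (hFree n (R.coroot i)) else 0)
  | eJf (i j : Fin n) :
      RelatorJ (⁅eFree H i, jFree (fFree H j)⁆ - if i = j then jFree (hFree n (R.coroot i)) else 0)
  | JeJf (i j : Fin n) :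
      RelatorJ (⁅jFree (eFree H i), jFree (fFree H j)⁆ +
        if i = j then hFree n (R.coroot i) else 0)

/-- The ideal `Î` of `ĝ` generated by all relators. -/
def ideal : LieIdeal ℂ (FreeLie n H) :=
  LieSubmodule.lieSpan ℂ (FreeLie n H) ({x | R.Relator₀ x} ∪ {x | R.RelatorJ x})

lemma mem_ideal₀ {x : FreeLie n H} (hx : R.Relator₀ x) : x ∈ R.ideal :=
  LieSubmodule.subset_lieSpan (Or.inl hx)

lemma mem_idealJ {x : FreeLie n H} (hx : R.RelatorJ x) : x ∈ R.ideal :=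
  LieSubmodule.subset_lieSpan (Or.inr hx)

lemma jFree_relator₀ {x : FreeLie n H} (hx : R.Relator₀ x) : R.RelatorJ (jFree x) := by
  cases hx with
  | hh h h' => rw [← jFree_lie_right]; exact .hJh h h'
  | he h i => rw [map_sub, ← jFree_lie_left]; exact .Jhe h i
  | hf h i => rw [map_add, ← jFree_lie_left]; exact .Jhf h i
  | ef i j =>
    rw [map_sub, ← jFree_lie_left, apply_ite (jFree : FreeLie n H → FreeLie n H), map_zero]
    exact .Jef i j

/-- Every twisted relator is `± J y` or `- y` for an untwisted relator `y`. -/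
lemma relatorJ_cases {x : FreeLie n H} (hx : R.RelatorJ x) :
    ∃ y, R.Relator₀ y ∧ (x = jFree y ∨ x = -y) := by
  cases hx with
  | hJh h h' => exact ⟨_, .hh h h', Or.inl (jFree_lie_right _ _)⟩
  | JhJh h h' =>
    exact ⟨_, .hh h h', Or.inr (by rw [jFree_lie_left, jFree_lie_right, jFree_jFree])⟩
  | Jhe h i => exact ⟨_, .he h i, Or.inl (by rw [jFree_lie_left, map_sub])⟩
  | hJe h i => exact ⟨_, .he h i, Or.inl (by rw [jFree_lie_right, map_sub, map_smul])⟩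
  | JhJe h i =>
    exact ⟨_, .he h i, Or.inr (by rw [jFree_lie_left, jFree_lie_right, jFree_jFree]; abel)⟩
  | Jhf h i => exact ⟨_, .hf h i, Or.inl (by rw [jFree_lie_left, map_add])⟩
  | hJf h i => exact ⟨_, .hf h i, Or.inl (by rw [jFree_lie_right, map_add, map_smul])⟩
  | JhJf h i =>
    exact ⟨_, .hf h i, Or.inr (by rw [jFree_lie_left, jFree_lie_right, jFree_jFree]; abel)⟩
  | Jef i j =>
    exact ⟨_, .ef i j, Or.inl (by
      rw [jFree_lie_left, map_sub, apply_ite (jFree : FreeLie n H → FreeLie n H), map_zero])⟩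
  | eJf i j =>
    exact ⟨_, .ef i j, Or.inl (by
      rw [jFree_lie_right, map_sub, apply_ite (jFree : FreeLie n H → FreeLie n H), map_zero])⟩
  | JeJf i j =>
    exact ⟨_, .ef i j, Or.inr (by rw [jFree_lie_left, jFree_lie_right, jFree_jFree]; abel)⟩

/-- The ideal `Î` is stable under `J`. -/
lemma jFree_mem_ideal {x : FreeLie n H} (hx : x ∈ R.ideal) : jFree x ∈ R.ideal := by
  let S : LieSubmodule ℂ (FreeLie n H) (FreeLie n H) :=
    { carrier := {x | jFree x ∈ R.ideal}
      zero_mem' := by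
        change jFree 0 ∈ R.ideal
        rw [map_zero]; exact zero_mem _
      add_mem' := fun {a b} ha hb => by
        change jFree (a + b) ∈ R.ideal
        rw [map_add]; exact add_mem ha hb
      smul_mem' := fun c a ha => by
        change jFree (c • a) ∈ R.ideal
        rw [map_smul]; exact R.ideal.smul_mem c ha
      lie_mem := fun {a b} hb => by
        change jFree ⁅a, b⁆ ∈ R.ideal
        rw [← jFree_lie_right]; exact R.ideal.lie_mem hb }
  have hle : R.ideal ≤ S := by
    refine LieSubmodule.lieSpan_le.2 ?_
    rintro x (hx | hx)
    · exact R.mem_idealJ (R.jFree_relator₀ hx)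
    · obtain ⟨y, hy, rfl | rfl⟩ := R.relatorJ_cases hx
      · change jFree (jFree y) ∈ R.ideal
        rw [jFree_jFree]; exact neg_mem (R.mem_ideal₀ hy)
      · change jFree (-y) ∈ R.ideal
        rw [map_neg]; exact neg_mem (R.mem_idealJ (R.jFree_relator₀ hy))
  exact hle hx

/-- The universal Kac-Moody quaternion Lie algebra `g̃(A) = ĝ(A) / Î`. -/
def Universal : Type _ := FreeLie n H ⧸ R.ideal

instance : LieRing R.Universal := inferInstanceAs (LieRing (FreeLie n H ⧸ R.ideal))

instance : LieAlgebra ℂ R.Universal := inferInstanceAs (LieAlgebra ℂ (FreeLie n H ⧸ R.ideal))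

/-- `g̃(A)` as a real Lie algebra. -/
instance : LieAlgebra ℝ R.Universal where
  lie_smul r x y := by
    change ⁅x, (r : ℂ) • y⁆ = (r : ℂ) • ⁅x, y⁆
    exact lie_smul _ _ _

/-- The canonical projection `Ψ : ĝ(A) → g̃(A)`. -/
def proj : FreeLie n H →ₗ⁅ℂ⁆ R.Universal where
  toLinearMap := R.ideal.toSubmodule.mkQ
  map_lie' := rfl

/-- The operator `J` on `g̃(A)`. -/
def J : R.Universal →ₗ[ℂ] R.Universal :=
  Submodule.mapQ R.ideal.toSubmodule R.ideal.toSubmodule jFree (fun _ hx => R.jFree_mem_ideal hx)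

/-- The elements `e_i` of `g̃(A)`. -/
def e (i : Fin n) : R.Universal := R.proj (eFree H i)

/-- The elements `f_i` of `g̃(A)`. -/
def f (i : Fin n) : R.Universal := R.proj (fFree H i)

/-- The canonical map `H → g̃(A)`. -/
def h : H →ₗ[ℂ] R.Universal := (R.proj : FreeLie n H →ₗ[ℂ] R.Universal) ∘ₗ hFree n

/-- The image of `H` in `g̃(A)`. -/
def cartan : Submodule ℂ R.Universal := LinearMap.range R.h

/-- The image of `JH` in `g̃(A)`. -/
def cartanJ : Submodule ℂ R.Universal := LinearMap.range (R.J ∘ₗ R.h)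

/-- `Ñ⁺`, generated over `ℂ` by the `e_i` and the `J e_i`. -/
def nPos : LieSubalgebra ℂ R.Universal :=
  LieSubalgebra.lieSpan ℂ R.Universal (Set.range R.e ∪ Set.range fun i => R.J (R.e i))

/-- `Ñ⁻`, generated over `ℂ` by the `f_i` and the `J f_i`. -/
def nNeg : LieSubalgebra ℂ R.Universal :=
  LieSubalgebra.lieSpan ℂ R.Universal (Set.range R.f ∪ Set.range fun i => R.J (R.f i))

/-- `K`, generated over `ℂ` by `H` and `JH`. -/
def subK : LieSubalgebra ℂ R.Universal :=
  LieSubalgebra.lieSpan ℂ R.Universal ((R.cartan : Set R.Universal) ∪ R.cartanJ)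

/-- `Q⁺`, the set of all `∑ k_i α_i` with natural numbers `k_i`. -/
def posCone : AddSubmonoid (Module.Dual ℂ H) := AddSubmonoid.closure (Set.range R.root)

/-- The index set `Q⁺ \ {0}`. -/
def PosIndex : Type _ := {γ : Module.Dual ℂ H // γ ∈ R.posCone ∧ γ ≠ 0}

instance : DecidableEq R.PosIndex := Classical.decEq _

/-- `H_r ⊆ H` is a real form of `H` compatible with the realization: it is a real subspace with
`H = H_r ⊕ √-1 H_r` that contains the `α_i^∨` and on which the `α_i` take real values. -/
structure IsRealForm (Hr : Submodule ℝ H) : Prop where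
  exists_unique : ∀ x : H, ∃! p : Hr × Hr, x = (p.1 : H) + Complex.I • (p.2 : H)
  coroot_mem : ∀ i, R.coroot i ∈ Hr
  root_real : ∀ i, ∀ x ∈ Hr, (R.root i x).im = 0

/-- The image of `H_r` in `g̃(A)`. -/
def realCartan (Hr : Submodule ℝ H) : Submodule ℝ R.Universal :=
  Hr.map (R.h.restrictScalars ℝ)

/-- The real form `g̃_r(A)` of `g̃₀(A)`: the real Lie subalgebra of `g̃(A)` generated by the `e_i`,
the `f_i` and `H_r`. -/
def realPart (Hr : Submodule ℝ H) : LieSubalgebra ℝ R.Universal :=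
  LieSubalgebra.lieSpan ℝ R.Universal
    (Set.range R.e ∪ Set.range R.f ∪ (R.realCartan Hr : Set R.Universal))

/-- The root space `g̃_γ = {x | [h, x] = ⟨γ, h⟩ x for all h ∈ H_r}`. -/
def rootSpace (Hr : Submodule ℝ H) (γ : Module.Dual ℂ H) : Submodule ℂ R.Universal where
  carrier := {x | ∀ t ∈ Hr, ⁅R.h t, x⁆ = γ t • x}
  zero_mem' := fun t _ => by rw [lie_zero, smul_zero]
  add_mem' := fun {a b} ha hb t ht => by rw [lie_add, smul_add, ha t ht, hb t ht]
  smul_mem' := fun c a ha t ht => by rw [lie_smul, ha t ht, smul_comm]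

/-- The family of subspaces `g̃_{-α}` (`0 ≠ α ∈ Q⁺`), `g̃_0`, `g̃_α` (`0 ≠ α ∈ Q⁺`). -/
def rootFamily (Hr : Submodule ℝ H) :
    R.PosIndex ⊕ (Unit ⊕ R.PosIndex) → Submodule ℂ R.Universal :=
  Sum.elim (fun γ => R.rootSpace Hr (-γ.1))
    (Sum.elim (fun _ => R.rootSpace Hr 0) (fun γ => R.rootSpace Hr γ.1))

end Realization

end KacMoodyQuaternion

end

/-! The operator `J` can be pulled out of either argument of the bracket and squares to -1
(`J_lie_left`, `J_lie_right`, `J_J`). Every twisted relator is therefore `J y` or `-y` for an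
untwisted relator `y`, and all relations in `g̃(A)` follow from the four untwisted families.

Since the simple roots are linearly independent, some `t ∈ H` gives all of them the same prescribed
value `c` (`exists_root_eq`). With `c = 1`, the operator `ad (h t)` has eigenvalue 1 on the `e_i`
and `J e_i`, -1 on the `f_i` and `J f_i`, and 0 on `K`. The usual bracket computation
(`lieSpan_le_triangular`) shows that `Ñ⁻ + K + Ñ⁺` is everything. Eigenspaces for distinct
eigenvalues are independent, so the sum is direct, and the eigenspace of an integer is exactly `K`
or a span of brackets of one fixed length (`IsPrincipal.eigenspace_eq`), hence finite-dimensional.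
Whatever commutes with `h t` thus lies in `K`, which makes `K` maximal commutative. The space `g̃_γ`
lies in the eigenspace of `γ t`, which for `±γ ∈ Q⁺` is plus or minus the height; this places it in
`Ñ⁺`, `K` or `Ñ⁻`. With `c = √-1`, the same operator turns real generation into complex generation.

What remains is that `H ⊕ JH` does not collapse in the quotient. Each `Λ ∈ H^*` gives a Verma-type
action of the untwisted relations on the words in the `f_i` (`wordRep`). Tensored with the
quaternions, it kills `Î`. An equality `h t = J (h t')` then compares a multiple of 1 with a
multiple of `j`, so `t` acts by zero; on the empty word it acts by `Λ t`. Hence `Λ t = 0` for every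
`Λ`, and `t = 0` (`eq_zero_of_h_eq_J_h`).

For a real form, the spanning argument is repeated over `ℝ`, and directness is inherited from the
complex decomposition (`IsRealForm.mem_realCartan`). -/

namespace KacMoodyQuaternion

/-! ### Lie subalgebras generated by a set -/

section LieSpan

variable {𝕜 L : Type*} [CommRing 𝕜] [LieRing L] [LieAlgebra 𝕜 L]

/-- A subspace that contains `E` and is stable under the operators `ad x`, `x ∈ E`, contains the
Lie subalgebra generated by `E`. -/
lemma lieSpan_le_of_lie_mem {E : Set L} {T : Submodule 𝕜 L} (hE : E ⊆ T)
    (hT : ∀ x ∈ E, ∀ y ∈ T, ⁅x, y⁆ ∈ T) :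
    (LieSubalgebra.lieSpan 𝕜 L E).toSubmodule ≤ T := by
  intro x hx
  -- The elements whose `ad` preserves `T` are closed under brackets by the Jacobi identity;
  -- carrying this along makes the induction close.
  suffices h : x ∈ T ∧ ∀ y ∈ T, ⁅x, y⁆ ∈ T from h.1
  replace hx : x ∈ LieSubalgebra.lieSpan 𝕜 L E := hx
  induction hx using LieSubalgebra.lieSpan_induction with
  | mem x h => exact ⟨hE h, hT x h⟩
  | zero => exact ⟨zero_mem _, fun y _ => by rw [zero_lie]; exact zero_mem _⟩
  | add x y hx hy ihx ihy =>
    exact ⟨add_mem ihx.1 ihy.1, fun z hz => by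
      rw [add_lie]; exact add_mem (ihx.2 z hz) (ihy.2 z hz)⟩
  | smul a x hx ih =>
    exact ⟨T.smul_mem a ih.1, fun z hz => by
      rw [smul_lie]; exact T.smul_mem a (ih.2 z hz)⟩
  | lie x y hx hy ihx ihy =>
    exact ⟨ihx.2 y ihy.1, fun z hz => by
      rw [lie_lie]
      exact sub_mem (ihx.2 _ (ihy.2 z hz)) (ihy.2 _ (ihx.2 z hz))⟩

/-- If `ad k` maps `E` to the subalgebra generated by `E`, it normalizes this subalgebra. -/
lemma lie_mem_lieSpan_of_lie_mem {E : Set L} {k : L}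
    (hk : ∀ x ∈ E, ⁅k, x⁆ ∈ LieSubalgebra.lieSpan 𝕜 L E) {y : L}
    (hy : y ∈ LieSubalgebra.lieSpan 𝕜 L E) : ⁅k, y⁆ ∈ LieSubalgebra.lieSpan 𝕜 L E := by
  induction hy using LieSubalgebra.lieSpan_induction with
  | mem x h => exact hk x h
  | zero => rw [lie_zero]; exact zero_mem _
  | add x y hx hy ihx ihy => rw [lie_add]; exact add_mem ihx ihy
  | smul a x hx ih => rw [lie_smul]; exact LieSubalgebra.smul_mem _ a ih
  | lie x y hx hy ihx ihy =>
    rw [leibniz_lie]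
    exact add_mem (LieSubalgebra.lie_mem _ ihx hy) (LieSubalgebra.lie_mem _ hx ihy)

/-- If `ad x` maps the generators `F` to a subspace `K` normalizing the subalgebra generated by
`F`, it maps this subalgebra to its sum with `K`. -/
lemma lie_mem_lieSpan_sup {F : Set L} {K : Submodule 𝕜 L} {x : L} (hx : ∀ y ∈ F, ⁅x, y⁆ ∈ K)
    (hK : ∀ k ∈ K, ∀ y ∈ F, ⁅k, y⁆ ∈ LieSubalgebra.lieSpan 𝕜 L F) {y : L}
    (hy : y ∈ LieSubalgebra.lieSpan 𝕜 L F) :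
    ⁅x, y⁆ ∈ (LieSubalgebra.lieSpan 𝕜 L F).toSubmodule ⊔ K := by
  -- By the Leibniz rule, `ad x` of a bracket is a sum of brackets of an element of `N + K` with one
  -- of `N`, where `N` is the subalgebra generated by `F`. These land in `N` because `K` normalizes
  -- it.
  have key : ∀ u ∈ (LieSubalgebra.lieSpan 𝕜 L F).toSubmodule ⊔ K,
      ∀ v ∈ LieSubalgebra.lieSpan 𝕜 L F, ⁅u, v⁆ ∈ (LieSubalgebra.lieSpan 𝕜 L F).toSubmodule := by
    intro u hu v hv
    obtain ⟨a, ha, k, hk, rfl⟩ := Submodule.mem_sup.1 hu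
    rw [add_lie]
    exact add_mem (LieSubalgebra.lie_mem _ ha hv) (lie_mem_lieSpan_of_lie_mem (hK k hk) hv)
  induction hy using LieSubalgebra.lieSpan_induction with
  | mem y h => exact Submodule.mem_sup_right (hx y h)
  | zero => rw [lie_zero]; exact zero_mem _
  | add y z hy hz ihy ihz => rw [lie_add]; exact add_mem ihy ihz
  | smul a y hy ih => rw [lie_smul]; exact Submodule.smul_mem _ a ih
  | lie y z hy hz ihy ihz =>
    rw [leibniz_lie, ← lie_skew y]
    exact Submodule.mem_sup_left (add_mem (key _ ihy z hz) (neg_mem (key _ ihz y hy)))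

/-- The spanning part of a triangular decomposition. -/
lemma lieSpan_le_triangular {E F : Set L} {K : Submodule 𝕜 L}
    (hKE : ∀ k ∈ K, ∀ x ∈ E, ⁅k, x⁆ ∈ LieSubalgebra.lieSpan 𝕜 L E)
    (hKF : ∀ k ∈ K, ∀ x ∈ F, ⁅k, x⁆ ∈ LieSubalgebra.lieSpan 𝕜 L F)
    (hKK : ∀ k ∈ K, ∀ k' ∈ K, ⁅k, k'⁆ ∈ K)
    (hEF : ∀ x ∈ E, ∀ y ∈ F, ⁅x, y⁆ ∈ K) :
    (LieSubalgebra.lieSpan 𝕜 L (E ∪ F ∪ K)).toSubmodule ≤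
      (LieSubalgebra.lieSpan 𝕜 L F).toSubmodule ⊔ K ⊔
        (LieSubalgebra.lieSpan 𝕜 L E).toSubmodule := by
  have hF : (LieSubalgebra.lieSpan 𝕜 L F).toSubmodule ≤
    (LieSubalgebra.lieSpan 𝕜 L F).toSubmodule ⊔ K ⊔
        (LieSubalgebra.lieSpan 𝕜 L E).toSubmodule := le_sup_left.trans le_sup_left
  have hK : K ≤ (LieSubalgebra.lieSpan 𝕜 L F).toSubmodule ⊔ K ⊔
        (LieSubalgebra.lieSpan 𝕜 L E).toSubmodule := le_sup_right.trans le_sup_left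
  have hE : (LieSubalgebra.lieSpan 𝕜 L E).toSubmodule ≤
    (LieSubalgebra.lieSpan 𝕜 L F).toSubmodule ⊔ K ⊔
        (LieSubalgebra.lieSpan 𝕜 L E).toSubmodule := le_sup_right
  refine lieSpan_le_of_lie_mem ?_ ?_
  · rintro x ((hx | hx) | hx)
    · exact hE (LieSubalgebra.subset_lieSpan hx)
    · exact hF (LieSubalgebra.subset_lieSpan hx)
    · exact hK hx
  · intro x hx y hy
    obtain ⟨y', hy', c, hc, rfl⟩ := Submodule.mem_sup.1 hy
    obtain ⟨a, ha, k, hk, rfl⟩ := Submodule.mem_sup.1 hy'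
    rw [lie_add, lie_add]
    -- Only the bracket of a generator with the opposite subalgebra needs an argument; it stays in
    -- that subalgebra plus `K`. The case of `F` mirrors that of `E`.
    rcases hx with (hx | hx) | hx
    · refine add_mem (add_mem ?_ ?_) (hE (LieSubalgebra.lie_mem _
        (LieSubalgebra.subset_lieSpan hx) hc))
      · exact (sup_le hF hK) (lie_mem_lieSpan_sup (hEF x hx) hKF ha)
      · rw [← lie_skew]; exact neg_mem (hE (hKE k hk x hx))
    · refine add_mem (add_mem (hF (LieSubalgebra.lie_mem _
        (LieSubalgebra.subset_lieSpan hx) ha)) ?_) ?_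
      · rw [← lie_skew]; exact neg_mem (hF (hKF k hk x hx))
      · refine (sup_le hE hK) (lie_mem_lieSpan_sup (fun y hy => ?_) hKE hc)
        rw [← lie_skew]; exact neg_mem (hEF y hy x hx)
    · exact add_mem (add_mem (hF (lie_mem_lieSpan_of_lie_mem (hKF x hx) ha)) (hK (hKK x hx k hk)))
        (hE (lie_mem_lieSpan_of_lie_mem (hKE x hx) hc))

variable (𝕜) in
/-- The span of the right-normed brackets of `k + 1` elements of `E`. -/
def bracketPower (E : Set L) : ℕ → Submodule 𝕜 L
  | 0 => Submodule.span 𝕜 E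
  | k + 1 => Submodule.map₂ (LieAlgebra.ad 𝕜 L : L →ₗ[𝕜] Module.End 𝕜 L) (Submodule.span 𝕜 E)
      (bracketPower E k)

lemma bracketPower_fg {E : Set L} (hE : E.Finite) (k : ℕ) : (bracketPower 𝕜 E k).FG := by
  induction k with
  | zero => exact Submodule.fg_span hE
  | succ k ih => exact (Submodule.fg_span hE).map₂ _ ih

lemma bracketPower_le_lieSpan (E : Set L) (k : ℕ) :
    bracketPower 𝕜 E k ≤ (LieSubalgebra.lieSpan 𝕜 L E).toSubmodule := by
  induction k with
  | zero => exact LieSubalgebra.submodule_span_le_lieSpan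
  | succ k ih =>
    exact Submodule.map₂_le.2 fun x hx y hy =>
      LieSubalgebra.lie_mem _ (LieSubalgebra.submodule_span_le_lieSpan hx) (ih hy)

/-- Right-normed brackets suffice: `ad x` with `x ∈ E` sends the `k`-th power to the next one, so
their sum is stable under all such operators. -/
lemma lieSpan_le_iSup_bracketPower (E : Set L) :
    (LieSubalgebra.lieSpan 𝕜 L E).toSubmodule ≤ ⨆ k, bracketPower 𝕜 E k := by
  refine lieSpan_le_of_lie_mem (fun x hx => ?_) fun x hx y hy => ?_
  · exact Submodule.mem_iSup_of_mem 0 (Submodule.subset_span hx)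
  · induction hy using Submodule.iSup_induction' with
    | mem k y hy =>
      exact Submodule.mem_iSup_of_mem (k + 1)
        (Submodule.apply_mem_map₂ _ (Submodule.subset_span hx) hy)
    | zero => rw [lie_zero]; exact zero_mem _
    | add y z _ _ ihy ihz => rw [lie_add]; exact add_mem ihy ihz

lemma iSup_bracketPower (E : Set L) :
    ⨆ k, bracketPower 𝕜 E k = (LieSubalgebra.lieSpan 𝕜 L E).toSubmodule :=
  le_antisymm (iSup_le (bracketPower_le_lieSpan E)) (lieSpan_le_iSup_bracketPower E)

lemma lie_mem_eigenspace_ad {z x y : L} {a b : 𝕜}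
    (hx : x ∈ Module.End.eigenspace (LieAlgebra.ad 𝕜 L z) a)
    (hy : y ∈ Module.End.eigenspace (LieAlgebra.ad 𝕜 L z) b) :
    ⁅x, y⁆ ∈ Module.End.eigenspace (LieAlgebra.ad 𝕜 L z) (a + b) := by
  rw [Module.End.mem_eigenspace_iff, LieAlgebra.ad_apply] at *
  rw [leibniz_lie, hx, hy, smul_lie, lie_smul, add_smul]

lemma bracketPower_le_eigenspace {E : Set L} {z : L} {a : 𝕜}
    (hE : E ⊆ Module.End.eigenspace (LieAlgebra.ad 𝕜 L z) a) (k : ℕ) :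
    bracketPower 𝕜 E k ≤ Module.End.eigenspace (LieAlgebra.ad 𝕜 L z) ((k + 1) * a) := by
  induction k with
  | zero => simpa [bracketPower] using Submodule.span_le.2 hE
  | succ k ih =>
    refine Submodule.map₂_le.2 fun x hx y hy => ?_
    have := lie_mem_eigenspace_ad (Submodule.span_le.2 hE hx) (ih hy)
    -- The power of index `k` has `k + 1` factors, whence the shift in the eigenvalue.
    rw [show ((k + 1 : ℕ) + 1 : 𝕜) * a = a + (k + 1) * a by push_cast; ring]
    exact this

end LieSpan

/-- Spanning subspaces of an independent family are the whole family. -/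
lemma iSupIndep_eq_of_le {ι α : Type*} [CompleteLattice α] [IsModularLattice α] {p q : ι → α}
    (hp : iSupIndep p) (hq : ∀ i, q i ≤ p i) (h : ⨆ i, q i = ⊤) (i : ι) : p i = q i := by
  -- Replacing every member except the `i`-th by the larger `p j` still gives the top; the modular
  -- law then cuts `p i` down to `q i`.
  have h1 : q i ⊔ ⨆ (j) (_ : j ≠ i), p j = ⊤ := by
    refine top_le_iff.1 (h ▸ iSup_le fun j => ?_)
    by_cases hj : j = i
    · subst hj; exact le_sup_left
    · exact le_sup_of_le_right ((hq j).trans (le_iSup₂_of_le j hj le_rfl))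
  calc p i = (q i ⊔ ⨆ (j) (_ : j ≠ i), p j) ⊓ p i := by rw [h1, top_inf_eq]
    _ = q i ⊔ (⨆ (j) (_ : j ≠ i), p j) ⊓ p i := (sup_inf_assoc_of_le _ (hq i)).trans rfl
    _ = q i := by rw [inf_comm, (hp i).eq_bot, sup_bot_eq]

/-! ### Principal gradings by the eigenvalues of one inner derivation -/

section Grading

variable {𝕜 L : Type*} [Field 𝕜] [LieRing L] [LieAlgebra 𝕜 L]

variable (𝕜) in
/-- The pieces of the principal grading attached to generators `E` of degree `1`, generators `F`
of degree `-1` and a subspace `K` of degree `0`. -/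
def principalPiece (E F : Set L) (K : Submodule 𝕜 L) : ℤ → Submodule 𝕜 L
  | Int.ofNat 0 => K
  | Int.ofNat (k + 1) => bracketPower 𝕜 E k
  | Int.negSucc k => bracketPower 𝕜 F k

/-- The hypotheses of a principal grading by the eigenvalues of `ad z`. -/
structure IsPrincipal (z : L) (E F : Set L) (K : Submodule 𝕜 L) : Prop where
  pos : E ⊆ Module.End.eigenspace (LieAlgebra.ad 𝕜 L z) 1
  neg : F ⊆ Module.End.eigenspace (LieAlgebra.ad 𝕜 L z) (-1)
  zero : K ≤ Module.End.eigenspace (LieAlgebra.ad 𝕜 L z) 0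
  span : (LieSubalgebra.lieSpan 𝕜 L F).toSubmodule ⊔ K ⊔
        (LieSubalgebra.lieSpan 𝕜 L E).toSubmodule = ⊤

namespace IsPrincipal

variable {z : L} {E F : Set L} {K : Submodule 𝕜 L}

lemma piece_le (h : IsPrincipal z E F K) (m : ℤ) :
    principalPiece 𝕜 E F K m ≤ Module.End.eigenspace (LieAlgebra.ad 𝕜 L z) (m : 𝕜) := by
  match m with
  | Int.ofNat 0 => simpa [principalPiece] using h.zero
  | Int.ofNat (k + 1) => simpa [principalPiece] using bracketPower_le_eigenspace h.pos k
  | Int.negSucc k =>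
    have := bracketPower_le_eigenspace h.neg k
    simpa [principalPiece, add_comm] using this

lemma iSup_piece (h : IsPrincipal z E F K) : ⨆ m, principalPiece 𝕜 E F K m = ⊤ := by
  rw [← top_le_iff, ← h.span, ← iSup_bracketPower, ← iSup_bracketPower]
  refine sup_le (sup_le (iSup_le fun k => ?_) ?_) (iSup_le fun k => ?_)
  · exact le_iSup (principalPiece 𝕜 E F K) (Int.negSucc k)
  · exact le_iSup (principalPiece 𝕜 E F K) (Int.ofNat 0)
  · exact le_iSup (principalPiece 𝕜 E F K) (Int.ofNat (k + 1))

/-- The pieces lie in eigenspaces and together span everything, so independence of the eigenspaces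
leaves room for nothing else. The pieces are grouped by the image of the degree in the field because
the characteristic is still arbitrary. -/
lemma eigenspace_eq_iSup (h : IsPrincipal z E F K) (μ : 𝕜) :
    Module.End.eigenspace (LieAlgebra.ad 𝕜 L z) μ =
      ⨆ (m : ℤ) (_ : (m : 𝕜) = μ), principalPiece 𝕜 E F K m := by
  refine iSupIndep_eq_of_le (Module.End.eigenspaces_iSupIndep (LieAlgebra.ad 𝕜 L z))
    (q := fun μ => ⨆ (m : ℤ) (_ : (m : 𝕜) = μ), principalPiece 𝕜 E F K m) (fun μ => ?_) ?_ μ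
  · refine iSup₂_le fun m hm => ?_
    subst hm
    exact h.piece_le m
  · rw [← top_le_iff, ← h.iSup_piece]
    exact iSup_le fun m => le_iSup_of_le (m : 𝕜) (le_iSup₂_of_le m rfl le_rfl)

lemma lieSpan_le_biSup_neg (F : Set L) : (LieSubalgebra.lieSpan 𝕜 L F).toSubmodule ≤
    ⨆ m ∈ Set.Iio (0 : ℤ), principalPiece 𝕜 E F K m := by
  rw [← iSup_bracketPower]
  exact iSup_le fun k => le_iSup₂_of_le (f := fun m (_ : m ∈ Set.Iio (0 : ℤ)) =>
    principalPiece 𝕜 E F K m) (Int.negSucc k) (Int.negSucc_lt_zero k) le_rfl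

lemma lieSpan_le_biSup_pos (E : Set L) : (LieSubalgebra.lieSpan 𝕜 L E).toSubmodule ≤
    ⨆ m ∈ Set.Ioi (0 : ℤ), principalPiece 𝕜 E F K m := by
  rw [← iSup_bracketPower]
  exact iSup_le fun k => le_iSup₂_of_le (f := fun m (_ : m ∈ Set.Ioi (0 : ℤ)) =>
    principalPiece 𝕜 E F K m) (Int.ofNat (k + 1)) (Int.natCast_succ_pos k) le_rfl

lemma le_biSup_zero : K ≤ ⨆ m ∈ ({0} : Set ℤ), principalPiece 𝕜 E F K m :=
  le_iSup₂_of_le (f := fun m (_ : m ∈ ({0} : Set ℤ)) =>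
    principalPiece 𝕜 E F K m) 0 rfl le_rfl

variable [CharZero 𝕜]

/-- In characteristic zero distinct degrees have distinct images, so each group consists of one
piece. -/
lemma eigenspace_eq (h : IsPrincipal z E F K) (m : ℤ) :
    Module.End.eigenspace (LieAlgebra.ad 𝕜 L z) (m : 𝕜) = principalPiece 𝕜 E F K m := by
  rw [h.eigenspace_eq_iSup]
  simp

lemma finiteDimensional_eigenspace (h : IsPrincipal z E F K) (hE : E.Finite) (hF : F.Finite)
    (hK : K.FG) (μ : 𝕜) :
    FiniteDimensional 𝕜 (Module.End.eigenspace (LieAlgebra.ad 𝕜 L z) μ) := by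
  rw [← Submodule.fg_iff_finiteDimensional]
  by_cases hμ : ∃ m : ℤ, (m : 𝕜) = μ
  · obtain ⟨m, rfl⟩ := hμ
    rw [h.eigenspace_eq]
    match m with
    | Int.ofNat 0 => exact hK
    | Int.ofNat (k + 1) => exact bracketPower_fg hE k
    | Int.negSucc k => exact bracketPower_fg hF k
  -- No piece belongs to a non-integral eigenvalue, so the eigenspace is zero.
  · rw [h.eigenspace_eq_iSup]
    push Not at hμ
    simp [hμ, Submodule.fg_bot]

lemma iSupIndep_piece (h : IsPrincipal z E F K) : iSupIndep (principalPiece 𝕜 E F K) := by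
  have := (Module.End.eigenspaces_iSupIndep (LieAlgebra.ad 𝕜 L z)).comp
    (Int.cast_injective (α := 𝕜))
  exact this.mono h.piece_le

/-- Partial sums of an independent family over disjoint sets of degrees are disjoint. Here and in
the next two lemmas the degrees are split by sign. -/
lemma disjoint_neg (h : IsPrincipal z E F K) :
    Disjoint (LieSubalgebra.lieSpan 𝕜 L F).toSubmodule
      (K ⊔ (LieSubalgebra.lieSpan 𝕜 L E).toSubmodule) := by
  refine (h.iSupIndep_piece.disjoint_biSup_biSup
    (s := Set.Iio 0) (t := {0} ∪ Set.Ioi 0) ?_).mono (lieSpan_le_biSup_neg F) ?_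
  · rw [Set.disjoint_left]; simp
  · rw [iSup_union]
    exact sup_le_sup le_biSup_zero (lieSpan_le_biSup_pos E)

lemma disjoint_zero (h : IsPrincipal z E F K) :
    Disjoint K ((LieSubalgebra.lieSpan 𝕜 L F).toSubmodule ⊔
      (LieSubalgebra.lieSpan 𝕜 L E).toSubmodule) := by
  refine (h.iSupIndep_piece.disjoint_biSup_biSup
    (s := {0}) (t := Set.Iio 0 ∪ Set.Ioi 0) ?_).mono le_biSup_zero ?_
  · rw [Set.disjoint_left]; simp
  · rw [iSup_union]
    exact sup_le_sup (lieSpan_le_biSup_neg F) (lieSpan_le_biSup_pos E)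

lemma disjoint_pos (h : IsPrincipal z E F K) :
    Disjoint (LieSubalgebra.lieSpan 𝕜 L E).toSubmodule
      ((LieSubalgebra.lieSpan 𝕜 L F).toSubmodule ⊔ K) := by
  refine (h.iSupIndep_piece.disjoint_biSup_biSup
    (s := Set.Ioi 0) (t := Set.Iio 0 ∪ {0}) ?_).mono (lieSpan_le_biSup_pos E) ?_
  · rw [Set.disjoint_left]; simp
  · rw [iSup_union]
    exact sup_le_sup (lieSpan_le_biSup_neg F) le_biSup_zero

lemma isInternal (h : IsPrincipal z E F K) :
    DirectSum.IsInternal ![(LieSubalgebra.lieSpan 𝕜 L F).toSubmodule, K,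
      (LieSubalgebra.lieSpan 𝕜 L E).toSubmodule] := by
  refine DirectSum.isInternal_submodule_of_iSupIndep_of_iSup_eq_top ?_ ?_
  · intro i
    fin_cases i
    · refine h.disjoint_neg.mono_right (iSup₂_le fun j hj => ?_)
      fin_cases j
      · exact absurd rfl hj
      · exact le_sup_left
      · exact le_sup_right
    · refine h.disjoint_zero.mono_right (iSup₂_le fun j hj => ?_)
      fin_cases j
      · exact le_sup_left
      · exact absurd rfl hj
      · exact le_sup_right
    · refine h.disjoint_pos.mono_right (iSup₂_le fun j hj => ?_)
      fin_cases j
      · exact le_sup_left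
      · exact le_sup_right
      · exact absurd rfl hj
  · rw [← h.span]
    refine le_antisymm (iSup_le fun j => ?_) (sup_le (sup_le ?_ ?_) ?_)
    · fin_cases j
      · exact le_sup_left.trans le_sup_left
      · exact le_sup_right.trans le_sup_left
      · exact le_sup_right
    · exact le_iSup (![(LieSubalgebra.lieSpan 𝕜 L F).toSubmodule, K,
        (LieSubalgebra.lieSpan 𝕜 L E).toSubmodule]) 0
    · exact le_iSup (![(LieSubalgebra.lieSpan 𝕜 L F).toSubmodule, K,
        (LieSubalgebra.lieSpan 𝕜 L E).toSubmodule]) 1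
    · exact le_iSup (![(LieSubalgebra.lieSpan 𝕜 L F).toSubmodule, K,
        (LieSubalgebra.lieSpan 𝕜 L E).toSubmodule]) 2

end IsPrincipal

end Grading

end KacMoodyQuaternion

namespace KacMoodyQuaternion

/-! ### Relations and generators of the universal algebra -/

namespace Realization

variable {n : ℕ} {A : Matrix (Fin n) (Fin n) ℤ} {H : Type*} [AddCommGroup H] [Module ℂ H]
  (R : Realization A H)

lemma J_proj (x : FreeLie n H) : R.J (R.proj x) = R.proj (jFree x) := rfl

lemma proj_surjective : Function.Surjective R.proj := Submodule.mkQ_surjective _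

lemma proj_eq_zero_iff {x : FreeLie n H} : R.proj x = 0 ↔ x ∈ R.ideal :=
  Submodule.Quotient.mk_eq_zero _

lemma J_J (x : R.Universal) : R.J (R.J x) = -x := by
  obtain ⟨x, rfl⟩ := R.proj_surjective x
  rw [J_proj, J_proj, jFree_jFree, map_neg]

/-- This comes from the free algebra, whose elements commute with the scalar `1 ⊗ j`. With its
mirror image it makes the bracket `J`-bilinear. -/
lemma J_lie_left (x y : R.Universal) : ⁅R.J x, y⁆ = R.J ⁅x, y⁆ := by
  obtain ⟨x, rfl⟩ := R.proj_surjective x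
  obtain ⟨y, rfl⟩ := R.proj_surjective y
  rw [J_proj, ← LieHom.map_lie, ← LieHom.map_lie, J_proj, jFree_lie_left]

lemma J_lie_right (x y : R.Universal) : ⁅x, R.J y⁆ = R.J ⁅x, y⁆ := by
  rw [← lie_skew, J_lie_left, ← map_neg, lie_skew]

lemma J_injective : Function.Injective R.J := fun x y h => by
  rw [← neg_inj, ← J_J, h, J_J]

lemma lie_h_e (t : H) (i : Fin n) : ⁅R.h t, R.e i⁆ = R.root i t • R.e i := by
  rw [← sub_eq_zero]
  change R.proj (⁅hFree n t, eFree H i⁆ - R.root i t • eFree H i) = 0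
  exact R.proj_eq_zero_iff.2 (R.mem_ideal₀ (.he t i))

lemma lie_h_f (t : H) (i : Fin n) : ⁅R.h t, R.f i⁆ = -(R.root i t • R.f i) := by
  rw [eq_neg_iff_add_eq_zero]
  change R.proj (⁅hFree n t, fFree H i⁆ + R.root i t • fFree H i) = 0
  exact R.proj_eq_zero_iff.2 (R.mem_ideal₀ (.hf t i))

lemma lie_h_h (t t' : H) : ⁅R.h t, R.h t'⁆ = 0 :=
  R.proj_eq_zero_iff.2 (R.mem_ideal₀ (.hh t t'))

lemma lie_e_f (i j : Fin n) : ⁅R.e i, R.f j⁆ = if i = j then R.h (R.coroot i) else 0 := by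
  have h : R.proj (⁅eFree H i, fFree H j⁆ - if i = j then hFree n (R.coroot i) else 0) = 0 :=
    R.proj_eq_zero_iff.2 (R.mem_ideal₀ (.ef i j))
  rw [map_sub, sub_eq_zero, apply_ite R.proj, map_zero] at h
  exact h

lemma relations_h (t : H) (i : Fin n) :
    ⁅R.h t, R.e i⁆ = R.root i t • R.e i ∧
    ⁅R.J (R.h t), R.e i⁆ = R.J (R.root i t • R.e i) ∧
    ⁅R.h t, R.J (R.e i)⁆ = R.root i t • R.J (R.e i) ∧
    ⁅R.J (R.h t), R.J (R.e i)⁆ = -(R.root i t • R.e i) ∧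
    ⁅R.h t, R.f i⁆ = -(R.root i t • R.f i) ∧
    ⁅R.J (R.h t), R.f i⁆ = -R.J (R.root i t • R.f i) ∧
    ⁅R.h t, R.J (R.f i)⁆ = -(R.root i t • R.J (R.f i)) ∧
    ⁅R.J (R.h t), R.J (R.f i)⁆ = R.root i t • R.f i := by
  simp only [J_lie_left, J_lie_right, lie_h_e, lie_h_f, J_J, map_neg, map_smul, smul_neg,
    neg_neg, and_self]

lemma relations_e_f (i j : Fin n) :
    ⁅R.e i, R.f j⁆ = (if i = j then R.h (R.coroot i) else 0) ∧
    ⁅R.J (R.e i), R.f j⁆ = (if i = j then R.J (R.h (R.coroot i)) else 0) ∧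
    ⁅R.e i, R.J (R.f j)⁆ = (if i = j then R.J (R.h (R.coroot i)) else 0) ∧
    ⁅R.J (R.e i), R.J (R.f j)⁆ = -(if i = j then R.h (R.coroot i) else 0) := by
  simp only [J_lie_left, J_lie_right, lie_e_f, J_J, apply_ite R.J, map_zero, true_and]
  split_ifs <;> simp

lemma relations_h_h (t t' : H) :
    ⁅R.h t, R.h t'⁆ = 0 ∧ ⁅R.h t, R.J (R.h t')⁆ = 0 ∧ ⁅R.J (R.h t), R.J (R.h t')⁆ = 0 := by
  simp only [J_lie_left, J_lie_right, lie_h_h, map_zero, and_self]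

/-- The generators of positive degree. -/
def posGen : Set R.Universal := Set.range R.e ∪ Set.range fun i => R.J (R.e i)

/-- The generators of negative degree. -/
def negGen : Set R.Universal := Set.range R.f ∪ Set.range fun i => R.J (R.f i)

lemma posGen_finite : R.posGen.Finite := (Set.finite_range _).union (Set.finite_range _)

lemma negGen_finite : R.negGen.Finite := (Set.finite_range _).union (Set.finite_range _)

lemma h_mem_cartan (t : H) : R.h t ∈ R.cartan := ⟨t, rfl⟩

lemma J_h_mem_cartanJ (t : H) : R.J (R.h t) ∈ R.cartanJ := ⟨t, rfl⟩

lemma lie_sup_cartan {x y : R.Universal} (hx : x ∈ R.cartan ⊔ R.cartanJ)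
    (hy : y ∈ R.cartan ⊔ R.cartanJ) : ⁅x, y⁆ = 0 := by
  obtain ⟨_, ⟨a, rfl⟩, _, ⟨b, rfl⟩, rfl⟩ := Submodule.mem_sup.1 hx
  obtain ⟨_, ⟨c, rfl⟩, _, ⟨d, rfl⟩, rfl⟩ := Submodule.mem_sup.1 hy
  simp [J_lie_left, J_lie_right, lie_h_h]

lemma subK_eq : R.subK.toSubmodule = R.cartan ⊔ R.cartanJ := by
  refine le_antisymm (lieSpan_le_of_lie_mem ?_ ?_) (sup_le ?_ ?_)
  · rintro x (hx | hx)
    · exact Submodule.mem_sup_left hx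
    · exact Submodule.mem_sup_right hx
  · rintro x hx y hy
    rw [lie_sup_cartan R ?_ hy]
    · exact zero_mem _
    · rcases hx with hx | hx
      · exact Submodule.mem_sup_left hx
      · exact Submodule.mem_sup_right hx
  · exact fun x hx => LieSubalgebra.subset_lieSpan (Or.inl hx)
  · exact fun x hx => LieSubalgebra.subset_lieSpan (Or.inr hx)

lemma lie_subK {x y : R.Universal} (hx : x ∈ R.subK) (hy : y ∈ R.subK) : ⁅x, y⁆ = 0 := by
  rw [← LieSubalgebra.mem_toSubmodule, subK_eq] at hx hy
  exact R.lie_sup_cartan hx hy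

lemma J_proj_genFree (v : GenSpace n H) :
    R.J (R.proj (genFree v)) = R.proj ⟨genJ n H v, genJ_mem v⟩ := by
  rw [J_proj]
  congr 1
  exact Subtype.ext (qJ_mul_gen v)

/-- The free algebra is generated by all vectors of the generating space; this reduces them to the
`e_i`, the `f_i` and `H`. -/
lemma genFree_eq (v : GenSpace n H) :
    genFree v = ∑ i, v.1 i • eFree H i + ∑ i, v.2.1 i • fFree H i + hFree n v.2.2 := by
  have h : v = ∑ i, v.1 i • ((Pi.single i 1, 0, 0) : GenSpace n H) +
      ∑ i, v.2.1 i • ((0, Pi.single i 1, 0) : GenSpace n H) + (0, 0, v.2.2) := by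
    obtain ⟨a, b, t⟩ := v
    refine Prod.ext ?_ (Prod.ext ?_ ?_)
    · ext k; simp [Prod.fst_sum, Finset.sum_apply, Pi.single_apply]
    · ext k; simp [Prod.fst_sum, Prod.snd_sum, Finset.sum_apply, Pi.single_apply]
    · simp [Prod.snd_sum]
  conv_lhs => rw [h]
  simp only [map_add, map_sum, map_smul]
  rfl

/-- The complex generators of `g̃(A)` generate it. -/
lemma lieSpan_generators_eq_top :
    LieSubalgebra.lieSpan ℂ R.Universal
      (R.posGen ∪ R.negGen ∪ (R.cartan ⊔ R.cartanJ : Submodule ℂ R.Universal)) = ⊤ := by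
  set C := LieSubalgebra.lieSpan ℂ R.Universal
      (R.posGen ∪ R.negGen ∪ (R.cartan ⊔ R.cartanJ : Submodule ℂ R.Universal)) with hC
  have hpos : ∀ x ∈ R.posGen, x ∈ C := fun x hx => LieSubalgebra.subset_lieSpan (Or.inl (Or.inl hx))
  have hneg : ∀ x ∈ R.negGen, x ∈ C := fun x hx => LieSubalgebra.subset_lieSpan (Or.inl (Or.inr hx))
  have hcar : ∀ x ∈ R.cartan ⊔ R.cartanJ, x ∈ C := fun x hx =>
    LieSubalgebra.subset_lieSpan (Or.inr hx)
  have hgen : ∀ v, R.proj (genFree v) ∈ C := fun v => by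
    rw [genFree_eq]
    simp only [map_add, map_sum, map_smul]
    refine add_mem (add_mem (sum_mem fun i _ => C.smul_mem _ ?_)
      (sum_mem fun i _ => C.smul_mem _ ?_)) ?_
    · exact hpos _ (Or.inl ⟨i, rfl⟩)
    · exact hneg _ (Or.inl ⟨i, rfl⟩)
    · exact hcar _ (Submodule.mem_sup_left (R.h_mem_cartan _))
  have hgenJ : ∀ v, R.J (R.proj (genFree v)) ∈ C := fun v => by
    rw [genFree_eq]
    simp only [map_add, map_sum, map_smul]
    refine add_mem (add_mem (sum_mem fun i _ => C.smul_mem _ ?_)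
      (sum_mem fun i _ => C.smul_mem _ ?_)) ?_
    · exact hpos _ (Or.inr ⟨i, rfl⟩)
    · exact hneg _ (Or.inr ⟨i, rfl⟩)
    · exact hcar _ (Submodule.mem_sup_right (R.J_h_mem_cartanJ _))
  refine eq_top_iff.2 fun x _ => ?_
  obtain ⟨⟨x, hx⟩, rfl⟩ := R.proj_surjective x
  induction hx using LieSubalgebra.lieSpan_induction with
  | mem x h =>
    rcases h with ⟨v, rfl⟩ | ⟨v, rfl⟩
    · exact hgen v
    · have := hgenJ v
      rwa [J_proj_genFree] at this
  | zero => exact zero_mem C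
  | add x y hx hy ihx ihy => exact add_mem (ihx trivial) (ihy trivial)
  | smul a x hx ih => exact C.smul_mem a (ih trivial)
  | lie x y hx hy ihx ihy => exact C.lie_mem (ihx trivial) (ihy trivial)

/-- An element of `H` on which the roots take prescribed values. -/
lemma exists_root_eq (c : ℂ) : ∃ t : H, ∀ i, R.root i t = c := by
  have := R.finiteDimensional
  -- Independence gives a functional on the dual with value 1 at every root; reflexivity realizes it
  -- by a vector of `H`.
  obtain ⟨F, hF⟩ := Module.exists_dual_forall_apply_eq_one (K := ℂ) R.root_indep.linearIndepOn_id
  refine ⟨c • (Module.evalEquiv ℂ H).symm F, fun i => ?_⟩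
  rw [map_smul, Module.apply_evalEquiv_symm_apply]
  simpa using congrArg (c * ·) (hF _ ⟨i, rfl⟩)

/-- The generators of `g̃(A)` generate it as a real Lie algebra. -/
lemma lieSpan_real_eq_top :
    LieSubalgebra.lieSpan ℝ R.Universal
      (Set.range R.e ∪ (Set.range fun i => R.J (R.e i)) ∪
        Set.range R.f ∪ (Set.range fun i => R.J (R.f i)) ∪
        (R.cartan : Set R.Universal) ∪ (R.cartanJ : Set R.Universal)) = ⊤ := by
  set S := LieSubalgebra.lieSpan ℝ R.Universal
      (Set.range R.e ∪ (Set.range fun i => R.J (R.e i)) ∪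
        Set.range R.f ∪ (Set.range fun i => R.J (R.f i)) ∪
        (R.cartan : Set R.Universal) ∪ (R.cartanJ : Set R.Universal)) with hS
  have hsmul : ∀ (r : ℝ) (x : R.Universal), x ∈ S → (r : ℂ) • x ∈ S := fun r x hx => S.smul_mem r hx
  -- The largest complex subspace contained in the real subalgebra `S`; it is again closed under
  -- brackets, so it suffices that it contains the complex generators.
  let C : LieSubalgebra ℂ R.Universal :=
    { carrier := {x | x ∈ S ∧ Complex.I • x ∈ S}
      zero_mem' := ⟨zero_mem S, by rw [smul_zero]; exact zero_mem S⟩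
      add_mem' := fun {a b} ha hb => ⟨add_mem ha.1 hb.1, by
        rw [smul_add]; exact add_mem ha.2 hb.2⟩
      smul_mem' := fun c a ha => by
        constructor
        · have : c • a = (c.re : ℂ) • a + (c.im : ℂ) • (Complex.I • a) := by
            rw [smul_smul, ← add_smul, Complex.re_add_im]
          rw [this]
          exact add_mem (hsmul _ _ ha.1) (hsmul _ _ ha.2)
        · have : Complex.I • c • a = (c.re : ℂ) • (Complex.I • a) + ((-c.im : ℝ) : ℂ) • a := by
            rw [smul_smul, smul_smul, ← add_smul]
            congr 1
            apply Complex.ext <;> simp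
          rw [this]
          exact add_mem (hsmul _ _ ha.2) (hsmul _ _ ha.1)
      lie_mem' := fun {a b} ha hb => ⟨S.lie_mem ha.1 hb.1, by
        rw [← smul_lie]; exact S.lie_mem ha.2 hb.1⟩ }
  have he (i) : R.e i ∈ S :=
    LieSubalgebra.subset_lieSpan (.inl (.inl (.inl (.inl (.inl ⟨i, rfl⟩)))))
  have hJe (i) : R.J (R.e i) ∈ S :=
    LieSubalgebra.subset_lieSpan (.inl (.inl (.inl (.inl (.inr ⟨i, rfl⟩)))))
  have hf (i) : R.f i ∈ S := LieSubalgebra.subset_lieSpan (.inl (.inl (.inl (.inr ⟨i, rfl⟩))))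
  have hJf (i) : R.J (R.f i) ∈ S := LieSubalgebra.subset_lieSpan (.inl (.inl (.inr ⟨i, rfl⟩)))
  have hc : ∀ x ∈ R.cartan, x ∈ S := fun x hx => LieSubalgebra.subset_lieSpan (.inl (.inr hx))
  have hcJ : ∀ x ∈ R.cartanJ, x ∈ S := fun x hx => LieSubalgebra.subset_lieSpan (.inr hx)
  -- For this `t`, bracketing with `h t ∈ S` multiplies the root generators by `±√-1`, so `S`
  -- contains their multiples by `√-1`.
  obtain ⟨t, ht⟩ := R.exists_root_eq Complex.I
  have hI {x : R.Universal} (hx : x ∈ S) (h : ⁅R.h t, x⁆ = Complex.I • x) : x ∈ C :=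
    ⟨hx, by rw [← h]; exact S.lie_mem (hc _ (R.h_mem_cartan t)) hx⟩
  have hI' {x : R.Universal} (hx : x ∈ S) (h : ⁅R.h t, x⁆ = -(Complex.I • x)) : x ∈ C :=
    ⟨hx, by rw [← neg_neg (Complex.I • x), ← h]
            exact neg_mem (S.lie_mem (hc _ (R.h_mem_cartan t)) hx)⟩
  have htop : (⊤ : LieSubalgebra ℂ R.Universal) ≤ C := by
    rw [← lieSpan_generators_eq_top, LieSubalgebra.lieSpan_le]
    rintro x (((⟨i, rfl⟩ | ⟨i, rfl⟩) | (⟨i, rfl⟩ | ⟨i, rfl⟩)) | hx)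
    · exact hI (he i) (by rw [lie_h_e, ht])
    · exact hI (hJe i) (by rw [J_lie_right, lie_h_e, ht, map_smul])
    · exact hI' (hf i) (by rw [lie_h_f, ht])
    · exact hI' (hJf i) (by rw [J_lie_right, lie_h_f, ht, map_neg, map_smul])
    · obtain ⟨a, ha, b, hb, rfl⟩ := Submodule.mem_sup.1 hx
      exact add_mem (S := LieSubalgebra ℂ R.Universal)
        ⟨hc _ ha, hc _ (R.cartan.smul_mem _ ha)⟩ ⟨hcJ _ hb, hcJ _ (R.cartanJ.smul_mem _ hb)⟩
  exact eq_top_iff.2 fun x _ => (htop (LieSubalgebra.mem_top x)).1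

end Realization

end KacMoodyQuaternion

noncomputable section

namespace KacMoodyQuaternion

namespace Realization

variable {n : ℕ} {A : Matrix (Fin n) (Fin n) ℤ} {H : Type*} [AddCommGroup H] [Module ℂ H]
  (R : Realization A H)

/-! ### Quaternionic extension of algebra maps on the tensor algebra -/

section Extension

variable {B : Type*} [Ring B] [Algebra ℂ B] (φ : T₀ n H →ₐ[ℂ] B)

/-- The extension of an algebra map on `T₀` to the quaternion tensor algebra. -/
def quatExtend : QTensor n H →ₐ[ℂ] B ⊗[ℝ] ℍ[ℝ] :=
  Algebra.TensorProduct.map φ (AlgHom.id ℝ ℍ[ℝ])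

lemma quatExtend_tens (u : T₀ n H) (c : ℍ[ℝ]) : quatExtend φ (tens n H u c) = φ u ⊗ₜ c := rfl

variable {φ}

/-- Untwisted relators involve only tensors with quaternion factor 1, where the extended map sees
just the commutators of `φ`. -/
lemma quatExtend_relator₀
    (hh : ∀ t t', ⁅φ (ι₀ n H (0, 0, t)), φ (ι₀ n H (0, 0, t'))⁆ = 0)
    (he : ∀ t i, ⁅φ (ι₀ n H (0, 0, t)), φ (ι₀ n H (Pi.single i 1, 0, 0))⁆ =
      R.root i t • φ (ι₀ n H (Pi.single i 1, 0, 0)))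
    (hf : ∀ t i, ⁅φ (ι₀ n H (0, 0, t)), φ (ι₀ n H (0, Pi.single i 1, 0))⁆ =
      -(R.root i t • φ (ι₀ n H (0, Pi.single i 1, 0))))
    (hef : ∀ i j, ⁅φ (ι₀ n H (Pi.single i 1, 0, 0)), φ (ι₀ n H (0, Pi.single j 1, 0))⁆ =
      if i = j then φ (ι₀ n H (0, 0, R.coroot i)) else 0)
    {x : FreeLie n H} (hx : R.Relator₀ x) : quatExtend φ (x : QTensor n H) = 0 := by
  have key (v w : GenSpace n H) :
      quatExtend φ ((⁅genFree v, genFree w⁆ : FreeLie n H) : QTensor n H) =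
        ⁅φ (ι₀ n H v), φ (ι₀ n H w)⁆ ⊗ₜ[ℝ] (1 : ℍ[ℝ]) := by
    change quatExtend φ ⁅gen n H v, gen n H w⁆ = _
    rw [LieRing.of_associative_ring_bracket, LieRing.of_associative_ring_bracket, map_sub, map_mul,
      map_mul, gen, gen, quatExtend_tens, quatExtend_tens, Algebra.TensorProduct.tmul_mul_tmul,
      Algebra.TensorProduct.tmul_mul_tmul, mul_one, TensorProduct.sub_tmul]
  cases hx with
  | hh t t' => exact (key _ _).trans (by
      change ⁅φ (ι₀ n H (0, 0, t)), φ (ι₀ n H (0, 0, t'))⁆ ⊗ₜ[ℝ] (1 : ℍ[ℝ]) = 0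
      rw [hh, TensorProduct.zero_tmul])
  | he t i =>
    change quatExtend φ (((⁅hFree n t, eFree H i⁆ : FreeLie n H) : QTensor n H) -
      R.root i t • ((eFree H i : FreeLie n H) : QTensor n H)) = 0
    rw [map_sub, map_smul, sub_eq_zero]
    refine (key _ _).trans ?_
    change ⁅φ (ι₀ n H (0, 0, t)), φ (ι₀ n H (Pi.single i 1, 0, 0))⁆ ⊗ₜ[ℝ] (1 : ℍ[ℝ]) = _
    rw [he]
    rfl
  | hf t i =>
    change quatExtend φ (((⁅hFree n t, fFree H i⁆ : FreeLie n H) : QTensor n H) +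
      R.root i t • ((fFree H i : FreeLie n H) : QTensor n H)) = 0
    rw [map_add, map_smul, ← eq_neg_iff_add_eq_zero]
    refine (key _ _).trans ?_
    change ⁅φ (ι₀ n H (0, 0, t)), φ (ι₀ n H (0, Pi.single i 1, 0))⁆ ⊗ₜ[ℝ] (1 : ℍ[ℝ]) = _
    rw [hf, TensorProduct.neg_tmul]
    rfl
  | ef i j =>
    change quatExtend φ (((⁅eFree H i, fFree H j⁆ : FreeLie n H) : QTensor n H) -
      ((if i = j then hFree n (R.coroot i) else 0 : FreeLie n H) : QTensor n H)) = 0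
    rw [map_sub, sub_eq_zero]
    refine (key _ _).trans ?_
    rw [hef]
    split_ifs
    · rfl
    · rw [TensorProduct.zero_tmul]
      exact (map_zero _).symm

/-- The kernel of an algebra map meets `ĝ` in an ideal, and it contains `J y` and `-y` along with
`y`; the untwisted relators therefore suffice. -/
lemma quatExtend_ideal
    (h₀ : ∀ x : FreeLie n H, R.Relator₀ x → quatExtend φ (x : QTensor n H) = 0)
    {x : FreeLie n H} (hx : x ∈ R.ideal) : quatExtend φ (x : QTensor n H) = 0 := by
  let S : LieSubmodule ℂ (FreeLie n H) (FreeLie n H) :=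
    { carrier := {x | quatExtend φ (x : QTensor n H) = 0}
      zero_mem' := map_zero _
      add_mem' := fun {a b} ha hb => by
        change quatExtend φ ((a : QTensor n H) + b) = 0
        rw [map_add, ha, hb, add_zero]
      smul_mem' := fun c a ha => by
        change quatExtend φ (c • (a : QTensor n H)) = 0
        rw [map_smul, ha, smul_zero]
      lie_mem := fun {a b} hb => by
        change quatExtend φ ⁅(a : QTensor n H), (b : QTensor n H)⁆ = 0
        rw [LieRing.of_associative_ring_bracket, map_sub, map_mul, map_mul, sub_eq_zero]
        replace hb : quatExtend φ (b : QTensor n H) = 0 := hb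
        exact (mul_eq_zero_of_right (M₀ := B ⊗[ℝ] ℍ[ℝ]) _ hb).trans
          (mul_eq_zero_of_left (M₀ := B ⊗[ℝ] ℍ[ℝ]) hb _).symm }
  have hle : R.ideal ≤ S := by
    refine LieSubmodule.lieSpan_le.2 ?_
    rintro x (hx | hx)
    · exact h₀ x hx
    · obtain ⟨y, hy, rfl | rfl⟩ := R.relatorJ_cases hx
      · change quatExtend φ (qJ n H * (y : QTensor n H)) = 0
        rw [map_mul]
        exact mul_eq_zero_of_right (M₀ := B ⊗[ℝ] ℍ[ℝ]) _ (h₀ y hy)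
      · change quatExtend φ (-(y : QTensor n H)) = 0
        rw [map_neg, h₀ y hy, neg_zero]
  exact hle hx

/-- The real part is a functional on the quaternions that is 1 at 1 and 0 at `j`; it is applied to
the second factor. -/
lemma eq_zero_of_tmul_one_eq_tmul_quatJ {a b : B}
    (h : a ⊗ₜ[ℝ] (1 : ℍ[ℝ]) = b ⊗ₜ[ℝ] quatJ) : a = 0 := by
  let re : ℍ[ℝ] →ₗ[ℝ] ℝ :=
    { toFun := fun q => q.re
      map_add' := fun _ _ => rfl
      map_smul' := fun _ _ => rfl }
  have h1 := congrArg (TensorProduct.rid ℝ B ∘ LinearMap.lTensor B re) h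
  simp only [Function.comp_apply, LinearMap.lTensor_tmul, TensorProduct.rid_tmul] at h1
  have h2 : re 1 = 1 := rfl
  have h3 : re quatJ = 0 := rfl
  rwa [h2, h3, one_smul, zero_smul] at h1

/-- An algebra map that kills the relators detects the Cartan part of `g̃(A)`. -/
lemma map_eq_zero_of_h_eq_J_h
    (h₀ : ∀ x : FreeLie n H, R.Relator₀ x → quatExtend φ (x : QTensor n H) = 0)
    {t t' : H} (h : R.h t = R.J (R.h t')) : φ (ι₀ n H (0, 0, t)) = 0 := by
  have h1 : R.proj (hFree n t - jFree (hFree n t')) = 0 := by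
    rw [map_sub, sub_eq_zero]; exact h
  have h2 := R.quatExtend_ideal h₀ (R.proj_eq_zero_iff.1 h1)
  change quatExtend φ (gen n H (0, 0, t) - qJ n H * gen n H (0, 0, t')) = 0 at h2
  rw [qJ_mul_gen, map_sub, sub_eq_zero] at h2
  exact eq_zero_of_tmul_one_eq_tmul_quatJ h2

end Extension

/-! ### Verma-type representations on words -/

section Verma

/-- The space of the free module of highest weight `Λ`, with basis the words in the `f_i`. -/
abbrev Words (n : ℕ) : Type := List (Fin n) →₀ ℂ

variable (Λ : Module.Dual ℂ H)

/-- The weight of a word. -/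
def wordWeight (w : List (Fin n)) : Module.Dual ℂ H := Λ - (w.map R.root).sum

lemma wordWeight_cons (i : Fin n) (w : List (Fin n)) :
    R.wordWeight Λ (i :: w) = R.wordWeight Λ w - R.root i := by
  simp only [wordWeight, List.map_cons, List.sum_cons]; abel

/-- The action of `f_i` on words. -/
def wordF (i : Fin n) : Module.End ℂ (Words n) :=
  Finsupp.linearCombination ℂ fun w => Finsupp.single (i :: w) 1

/-- The action of `H` on words. -/
def wordH : H →ₗ[ℂ] Module.End ℂ (Words n) where
  toFun t := Finsupp.linearCombination ℂ fun w => R.wordWeight Λ w t • Finsupp.single w 1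
  map_add' t t' := by ext w : 2; simp [add_smul]
  map_smul' c t := by ext w : 2; simp [mul_smul]

/-- The action of `e_i` on a word. -/
def wordEAux (i : Fin n) : List (Fin n) → Words n
  | [] => 0
  | j :: w => (if i = j then R.wordWeight Λ w (R.coroot i) • Finsupp.single w 1 else 0) +
      wordF j (wordEAux i w)

/-- The action of `e_i` on words. -/
def wordE (i : Fin n) : Module.End ℂ (Words n) :=
  Finsupp.linearCombination ℂ (R.wordEAux Λ i)

@[simp] lemma wordF_single (i : Fin n) (w : List (Fin n)) :
    wordF i (Finsupp.single w 1) = Finsupp.single (i :: w) 1 := by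
  simp [wordF]

@[simp] lemma wordH_single (t : H) (w : List (Fin n)) :
    R.wordH Λ t (Finsupp.single w 1) = R.wordWeight Λ w t • Finsupp.single w 1 := by
  simp [wordH]

@[simp] lemma wordE_single (i : Fin n) (w : List (Fin n)) :
    R.wordE Λ i (Finsupp.single w 1) = R.wordEAux Λ i w := by
  simp [wordE]

lemma words_hom_ext {f g : Module.End ℂ (Words n)}
    (h : ∀ w, f (Finsupp.single w 1) = g (Finsupp.single w 1)) : f = g :=
  Finsupp.lhom_ext' fun w => LinearMap.ext_ring (h w)

lemma lie_wordH_wordH (t t' : H) : ⁅R.wordH Λ t, R.wordH Λ t'⁆ = 0 := by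
  refine words_hom_ext fun w => ?_
  simp [LieRing.of_associative_ring_bracket, -Finsupp.smul_single, smul_smul, mul_comm]

lemma lie_wordH_wordF (t : H) (i : Fin n) :
    ⁅R.wordH Λ t, wordF i⁆ = -(R.root i t • wordF i) := by
  refine words_hom_ext fun w => ?_
  simp [LieRing.of_associative_ring_bracket, -Finsupp.smul_single, wordWeight_cons, sub_smul]

/-- The recursion defining `wordEAux` is this relation, with `e_i` killing the empty word. -/
lemma lie_wordE_wordF (i j : Fin n) :
    ⁅R.wordE Λ i, wordF j⁆ = if i = j then R.wordH Λ (R.coroot i) else 0 := by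
  refine words_hom_ext fun w => ?_
  split_ifs with h <;> simp [LieRing.of_associative_ring_bracket, wordEAux, h]

lemma lie_wordH_wordE (t : H) (i : Fin n) :
    ⁅R.wordH Λ t, R.wordE Λ i⁆ = R.root i t • R.wordE Λ i := by
  -- The operator `e_i` raises weights by `α_i`: a letter `f_j` lowers the weight by `α_j`, and in
  -- the term where `e_i` cancels `f_i` the two shifts compensate.
  have key (w : List (Fin n)) : R.wordH Λ t (R.wordEAux Λ i w) =
      (R.wordWeight Λ w t + R.root i t) • R.wordEAux Λ i w := by
    induction w with
    | nil => simp [wordEAux]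
    | cons j w ih =>
      have hF (y : Words n) : R.wordH Λ t (wordF j y) =
          wordF j (R.wordH Λ t y) - R.root j t • wordF j y := by
        have := LinearMap.congr_fun (R.lie_wordH_wordF Λ t j) y
        rw [LieRing.of_associative_ring_bracket] at this
        simp only [LinearMap.sub_apply, Module.End.mul_apply, LinearMap.neg_apply,
          LinearMap.smul_apply] at this
        rw [sub_eq_iff_eq_add] at this
        rw [this]; abel
      rw [wordEAux, map_add, hF, ih, map_smul, wordWeight_cons, smul_add, ← sub_smul]
      congr 1
      · split_ifs with h
        · subst h
          rw [map_smul, wordH_single, LinearMap.sub_apply, sub_add_cancel, smul_comm]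
        · simp
      · congr 1
        rw [LinearMap.sub_apply]; ring
  refine words_hom_ext fun w => ?_
  simp [LieRing.of_associative_ring_bracket, -Finsupp.smul_single, key, add_smul]

/-- The action of the tensor algebra on words. -/
def wordRep : T₀ n H →ₐ[ℂ] Module.End ℂ (Words n) :=
  TensorAlgebra.lift ℂ ((Fintype.linearCombination ℂ (R.wordE Λ)).coprod
    ((Fintype.linearCombination ℂ (wordF (n := n))).coprod (R.wordH Λ)))

lemma wordRep_ι₀ (v : GenSpace n H) : R.wordRep Λ (ι₀ n H v) =
    Fintype.linearCombination ℂ (R.wordE Λ) v.1 +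
      (Fintype.linearCombination ℂ (wordF (n := n)) v.2.1 + R.wordH Λ v.2.2) :=
  TensorAlgebra.lift_ι_apply _ _

lemma wordRep_relator₀ {x : FreeLie n H} (hx : R.Relator₀ x) :
    quatExtend (B := Module.End ℂ (Words n)) (R.wordRep Λ) (x : QTensor n H) = 0 := by
  have hh (t : H) : R.wordRep Λ (ι₀ n H (0, 0, t)) = R.wordH Λ t := by simp [wordRep_ι₀]
  have he (i : Fin n) : R.wordRep Λ (ι₀ n H (Pi.single i 1, 0, 0)) = R.wordE Λ i := by
    simp [wordRep_ι₀]
  have hf (i : Fin n) : R.wordRep Λ (ι₀ n H (0, Pi.single i 1, 0)) = wordF i := by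
    simp [wordRep_ι₀]
  refine R.quatExtend_relator₀ ?_ ?_ ?_ ?_ hx
  · intro t t'; rw [hh, hh, lie_wordH_wordH]
  · intro t i; rw [hh, he, lie_wordH_wordE]
  · intro t i; rw [hh, hf, lie_wordH_wordF]
  · intro i j; rw [hh, he, hf, lie_wordE_wordF]

end Verma

/-- `H` and `JH` are independent in `g̃(A)`, and `H` embeds. -/
lemma eq_zero_of_h_eq_J_h {t t' : H} (h : R.h t = R.J (R.h t')) : t = 0 := by
  refine (Module.forall_dual_apply_eq_zero_iff ℂ t).1 fun Λ => ?_
  have h1 := R.map_eq_zero_of_h_eq_J_h (fun x hx => R.wordRep_relator₀ Λ hx) h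
  -- The empty word has weight `Λ`, so this coefficient is `Λ t`.
  have h2 := congrArg (fun T => T (Finsupp.single [] 1) []) h1
  simpa [wordRep_ι₀, wordWeight] using h2

lemma h_injective : Function.Injective R.h := by
  refine (injective_iff_map_eq_zero R.h).2 fun t ht => ?_
  exact R.eq_zero_of_h_eq_J_h (t' := 0) (by rw [ht, map_zero, map_zero])

lemma disjoint_cartan_cartanJ : Disjoint R.cartan R.cartanJ := by
  rw [Submodule.disjoint_def]
  rintro _ ⟨t, rfl⟩ ⟨t', h⟩
  rw [R.eq_zero_of_h_eq_J_h h.symm, map_zero]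

end Realization

end KacMoodyQuaternion

end

/-! ### Triangular decomposition and maximality of `K` -/

noncomputable section

namespace KacMoodyQuaternion

namespace Realization

variable {n : ℕ} {A : Matrix (Fin n) (Fin n) ℤ} {H : Type*} [AddCommGroup H] [Module ℂ H]
  (R : Realization A H)

lemma e_mem_nPos (i : Fin n) : R.e i ∈ R.nPos := LieSubalgebra.subset_lieSpan (Or.inl ⟨i, rfl⟩)

lemma J_e_mem_nPos (i : Fin n) : R.J (R.e i) ∈ R.nPos :=
  LieSubalgebra.subset_lieSpan (Or.inr ⟨i, rfl⟩)

lemma f_mem_nNeg (i : Fin n) : R.f i ∈ R.nNeg := LieSubalgebra.subset_lieSpan (Or.inl ⟨i, rfl⟩)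

lemma J_f_mem_nNeg (i : Fin n) : R.J (R.f i) ∈ R.nNeg :=
  LieSubalgebra.subset_lieSpan (Or.inr ⟨i, rfl⟩)

lemma exists_of_mem_subK {k : R.Universal} (hk : k ∈ R.subK.toSubmodule) :
    ∃ a b, k = R.h a + R.J (R.h b) := by
  rw [subK_eq] at hk
  obtain ⟨_, ⟨a, rfl⟩, _, ⟨b, rfl⟩, rfl⟩ := Submodule.mem_sup.1 hk
  exact ⟨a, b, rfl⟩

lemma h_mem_subK (t : H) : R.h t ∈ R.subK :=
  LieSubalgebra.subset_lieSpan (Or.inl (R.h_mem_cartan t))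

lemma J_h_mem_subK (t : H) : R.J (R.h t) ∈ R.subK :=
  LieSubalgebra.subset_lieSpan (Or.inr (R.J_h_mem_cartanJ t))

lemma lie_mem_nPos {k x : R.Universal} (hk : k ∈ R.subK.toSubmodule) (hx : x ∈ R.posGen) :
    ⁅k, x⁆ ∈ R.nPos := by
  obtain ⟨a, b, rfl⟩ := R.exists_of_mem_subK hk
  have he (c : ℂ) (i : Fin n) := R.nPos.smul_mem c (R.e_mem_nPos i)
  have hJe (c : ℂ) (i : Fin n) := R.nPos.smul_mem c (R.J_e_mem_nPos i)
  rcases hx with ⟨i, rfl⟩ | ⟨i, rfl⟩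
  · simp only [add_lie, J_lie_left, lie_h_e, map_smul]
    exact add_mem (he _ i) (hJe _ i)
  · simp only [add_lie, J_lie_left, J_lie_right, lie_h_e, map_smul, J_J, smul_neg]
    exact add_mem (hJe _ i) (neg_mem (he _ i))

lemma lie_mem_nNeg {k x : R.Universal} (hk : k ∈ R.subK.toSubmodule) (hx : x ∈ R.negGen) :
    ⁅k, x⁆ ∈ R.nNeg := by
  obtain ⟨a, b, rfl⟩ := R.exists_of_mem_subK hk
  have hf (c : ℂ) (i : Fin n) := R.nNeg.smul_mem c (R.f_mem_nNeg i)
  have hJf (c : ℂ) (i : Fin n) := R.nNeg.smul_mem c (R.J_f_mem_nNeg i)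
  rcases hx with ⟨i, rfl⟩ | ⟨i, rfl⟩
  · simp only [add_lie, J_lie_left, lie_h_f, map_smul, map_neg]
    exact add_mem (neg_mem (hf _ i)) (neg_mem (hJf _ i))
  · simp only [add_lie, J_lie_left, J_lie_right, lie_h_f, map_smul, map_neg, J_J, smul_neg, neg_neg]
    exact add_mem (neg_mem (hJf _ i)) (hf _ i)

lemma lie_posGen_negGen {x y : R.Universal} (hx : x ∈ R.posGen) (hy : y ∈ R.negGen) :
    ⁅x, y⁆ ∈ R.subK.toSubmodule := by
  rcases hx with ⟨i, rfl⟩ | ⟨i, rfl⟩ <;> rcases hy with ⟨j, rfl⟩ | ⟨j, rfl⟩ <;>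
  simp only [J_lie_left, J_lie_right, lie_e_f, J_J, apply_ite R.J, map_zero] <;>
  split_ifs <;> simp [h_mem_subK, J_h_mem_subK]

/-- An element of `H` on which all simple roots are `1` induces a principal grading of `g̃(A)`. -/
lemma isPrincipal {t : H} (ht : ∀ i, R.root i t = 1) :
    IsPrincipal (R.h t) R.posGen R.negGen R.subK.toSubmodule where
  pos := by
    rintro x (⟨i, rfl⟩ | ⟨i, rfl⟩) <;>
    simp [J_lie_right, lie_h_e, ht]
  neg := by
    rintro x (⟨i, rfl⟩ | ⟨i, rfl⟩) <;>
    simp [J_lie_right, lie_h_f, ht]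
  zero := fun x hx => by
    rw [Module.End.mem_eigenspace_iff, zero_smul]
    exact R.lie_subK (R.h_mem_subK t) hx
  span := by
    have h := R.lieSpan_generators_eq_top
    rw [← subK_eq] at h
    rw [← top_le_iff, ← LieSubalgebra.top_toSubmodule, ← h]
    refine lieSpan_le_triangular (fun k hk x hx => R.lie_mem_nPos hk hx)
      (fun k hk x hx => R.lie_mem_nNeg hk hx) (fun k hk k' hk' => ?_)
      (fun x hx y hy => R.lie_posGen_negGen hx hy)
    rw [R.lie_subK hk hk']
    exact zero_mem _

lemma finite_subK : R.subK.toSubmodule.FG := by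
  have := R.finiteDimensional
  have hH : (⊤ : Submodule ℂ H).FG := Module.Finite.fg_top
  rw [subK_eq]
  refine Submodule.FG.sup ?_ ?_
  · rw [cartan, LinearMap.range_eq_map]; exact hH.map _
  · rw [cartanJ, LinearMap.range_eq_map]; exact hH.map _

/-- A complex Lie subalgebra of `g̃(A)` as a real Lie subalgebra. -/
def realSubalgebra (N : LieSubalgebra ℂ R.Universal) : LieSubalgebra ℝ R.Universal where
  carrier := N
  zero_mem' := zero_mem N
  add_mem' := add_mem
  smul_mem' := fun r _ hx => N.smul_mem (r : ℂ) hx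
  lie_mem' := N.lie_mem

/-- A commutative subalgebra containing `K` centralizes the grading element `h t`, and the
centralizer of that single element is the degree-zero piece `K`. -/
lemma maximal_subK : Maximal (fun L : LieSubalgebra ℝ R.Universal => ∀ x ∈ L, ∀ y ∈ L, ⁅x, y⁆ = 0)
    (R.realSubalgebra R.subK) := by
  refine ⟨fun x hx y hy => R.lie_subK hx hy, fun L hL hle y hy => ?_⟩
  obtain ⟨t, ht⟩ := R.exists_root_eq 1
  have h1 : y ∈ Module.End.eigenspace (LieAlgebra.ad ℂ R.Universal (R.h t)) ((0 : ℤ) : ℂ) := by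
    rw [Module.End.mem_eigenspace_iff, Int.cast_zero, zero_smul]
    exact hL _ (hle (R.h_mem_subK t)) _ hy
  rw [(R.isPrincipal ht).eigenspace_eq] at h1
  exact h1

/-! ### Root spaces and the real form -/

section RealForm

variable {R} {Hr : Submodule ℝ H}

/-- Both sides of the weight condition are complex linear in `t`, and `H_r` spans `H` over `ℂ`. -/
lemma IsRealForm.mem_rootSpace (hHr : R.IsRealForm Hr) {γ : Module.Dual ℂ H} {x : R.Universal} :
    x ∈ R.rootSpace Hr γ ↔ ∀ t, ⁅R.h t, x⁆ = γ t • x := by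
  refine ⟨fun hx t => ?_, fun hx t _ => hx t⟩
  obtain ⟨⟨p, q⟩, h, -⟩ := hHr.exists_unique t
  subst h
  have h1 : ⁅R.h p, x⁆ = γ p • x := hx p p.2
  have h2 : ⁅R.h q, x⁆ = γ q • x := hx q q.2
  rw [map_add, map_smul, add_lie, smul_lie, h1, h2, map_add, map_smul, add_smul, smul_assoc]

lemma IsRealForm.lie_mem_rootSpace (hHr : R.IsRealForm Hr) {γ δ : Module.Dual ℂ H}
    {x y : R.Universal} (hx : x ∈ R.rootSpace Hr γ) (hy : y ∈ R.rootSpace Hr δ) :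
    ⁅x, y⁆ ∈ R.rootSpace Hr (γ + δ) := by
  rw [hHr.mem_rootSpace] at *
  intro t
  rw [leibniz_lie, hx, hy, smul_lie, lie_smul, LinearMap.add_apply, add_smul]

lemma IsRealForm.rootSpace_le_eigenspace (hHr : R.IsRealForm Hr) (γ : Module.Dual ℂ H) (t : H) :
    R.rootSpace Hr γ ≤ Module.End.eigenspace (LieAlgebra.ad ℂ R.Universal (R.h t)) (γ t) :=
  fun _ hx => Module.End.mem_eigenspace_iff.2 (hHr.mem_rootSpace.1 hx t)

/-- The operators `ad (h t)` commute, so their simultaneous generalized eigenspaces are independent;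
distinct weights are distinct systems of eigenvalues. -/
lemma IsRealForm.iSupIndep_rootSpace (hHr : R.IsRealForm Hr) : iSupIndep (R.rootSpace Hr) := by
  have h := Module.End.independent_iInf_maxGenEigenspace_of_forall_mapsTo
    (fun t : H => LieAlgebra.ad ℂ R.Universal (R.h t)) (fun s t φ => by
      refine Module.End.mapsTo_maxGenEigenspace_of_comm ?_ φ
      refine LinearMap.ext fun x => ?_
      simp only [Module.End.mul_apply, LieAlgebra.ad_apply]
      rw [leibniz_lie, lie_h_h, zero_lie, zero_add])
  refine (h.comp (f := fun γ : Module.Dual ℂ H => (γ : H → ℂ)) DFunLike.coe_injective).mono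
    fun γ => le_iInf fun t => ?_
  exact (hHr.rootSpace_le_eigenspace γ t).trans
    Module.End.eigenspace_le_maxGenEigenspace

variable (R) in
/-- The value of an element of `Q⁺` at an element of `H` on which all simple roots are `1` is its
height. -/
lemma exists_height {t : H} (ht : ∀ i, R.root i t = 1) {γ : Module.Dual ℂ H}
    (hγ : γ ∈ R.posCone) : ∃ k : ℕ, γ t = k ∧ (γ ≠ 0 → k ≠ 0) := by
  induction hγ using AddSubmonoid.closure_induction with
  | mem γ h =>
    obtain ⟨i, rfl⟩ := h
    exact ⟨1, by simp [ht], fun _ => one_ne_zero⟩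
  | zero => exact ⟨0, by simp, fun h => absurd rfl h⟩
  | add γ δ _ _ ihγ ihδ =>
    obtain ⟨k, hk, hk'⟩ := ihγ
    obtain ⟨l, hl, hl'⟩ := ihδ
    refine ⟨k + l, by simp [hk, hl], fun h => ?_⟩
    by_cases h0 : γ = 0
    · have : δ ≠ 0 := fun h1 => h (by rw [h0, h1, add_zero])
      have := hl' this
      omega
    · have := hk' h0
      omega

variable (R) in
lemma exists_height_succ {t : H} (ht : ∀ i, R.root i t = 1) {γ : Module.Dual ℂ H}
    (hγ : γ ∈ R.posCone) (h0 : γ ≠ 0) : ∃ k : ℕ, γ t = k + 1 := by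
  obtain ⟨k, hk, hk'⟩ := R.exists_height ht hγ
  obtain ⟨l, rfl⟩ := Nat.exists_eq_succ_of_ne_zero (hk' h0)
  exact ⟨l, by rw [hk]; push_cast; rfl⟩

variable (R) in
lemma root_mem_posCone (i : Fin n) : R.root i ∈ R.posCone :=
  AddSubmonoid.subset_closure ⟨i, rfl⟩

variable (R) in
/-- The weight indexing a member of `rootFamily`. -/
def familyWeight : R.PosIndex ⊕ (Unit ⊕ R.PosIndex) → Module.Dual ℂ H :=
  Sum.elim (fun γ => -γ.1) (Sum.elim (fun _ => 0) (fun γ => γ.1))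

lemma rootFamily_eq (Hr : Submodule ℝ H) : R.rootFamily Hr = R.rootSpace Hr ∘ R.familyWeight := by
  funext i
  rcases i with γ | _ | γ <;> rfl

variable (R) in
lemma familyWeight_injective : Function.Injective R.familyWeight := by
  obtain ⟨t, ht⟩ := R.exists_root_eq 1
  -- Evaluated at `t`, the two sides are a negative and a positive integer.
  have hpn (γ δ : R.PosIndex) : -γ.1 ≠ δ.1 := fun h => by
    obtain ⟨k, hk⟩ := R.exists_height_succ ht γ.2.1 γ.2.2
    obtain ⟨l, hl⟩ := R.exists_height_succ ht δ.2.1 δ.2.2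
    have h1 := LinearMap.congr_fun h t
    rw [LinearMap.neg_apply, hk, hl, neg_eq_iff_add_eq_zero] at h1
    norm_cast at h1
  rintro (γ | _ | γ) (δ | _ | δ) h
  · exact congrArg Sum.inl (Subtype.ext (neg_injective h))
  · exact absurd (neg_eq_zero.1 h) γ.2.2
  · exact absurd h (hpn γ δ)
  · exact absurd (neg_eq_zero.1 h.symm) δ.2.2
  · rfl
  · exact absurd h.symm δ.2.2
  · exact absurd h.symm (hpn δ γ)
  · exact absurd h γ.2.2
  · exact congrArg (Sum.inr ∘ Sum.inr) (Subtype.ext h)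

lemma IsRealForm.posGen_mem (hHr : R.IsRealForm Hr) {x : R.Universal} (hx : x ∈ R.posGen) :
    ∃ i, x ∈ R.rootSpace Hr (R.root i) := by
  rcases hx with ⟨i, rfl⟩ | ⟨i, rfl⟩ <;> refine ⟨i, hHr.mem_rootSpace.2 fun t => ?_⟩
  · rw [lie_h_e]
  · rw [J_lie_right, lie_h_e, map_smul]

lemma IsRealForm.negGen_mem (hHr : R.IsRealForm Hr) {x : R.Universal} (hx : x ∈ R.negGen) :
    ∃ i, x ∈ R.rootSpace Hr (-R.root i) := by
  rcases hx with ⟨i, rfl⟩ | ⟨i, rfl⟩ <;> refine ⟨i, hHr.mem_rootSpace.2 fun t => ?_⟩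
  · rw [lie_h_f, LinearMap.neg_apply, neg_smul]
  · rw [J_lie_right, lie_h_f, map_neg, map_smul, LinearMap.neg_apply, neg_smul]

variable (R) in
lemma root_ne_zero (i : Fin n) : R.root i ≠ 0 := R.root_indep.ne_zero i

variable (R) in
lemma root_add_ne_zero (i : Fin n) {γ : Module.Dual ℂ H} (hγ : γ ∈ R.posCone) :
    R.root i + γ ≠ 0 := fun h => by
  obtain ⟨t, ht⟩ := R.exists_root_eq 1
  obtain ⟨k, hk, -⟩ := R.exists_height ht hγ
  have h1 := LinearMap.congr_fun h t
  rw [LinearMap.add_apply, ht, hk, LinearMap.zero_apply] at h1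
  norm_cast at h1
  omega

variable (R) in
/-- The sum of a simple root and an element of `Q⁺ \ {0}`. -/
def PosIndex.rootAdd (i : Fin n) (γ : R.PosIndex) : R.PosIndex :=
  ⟨R.root i + γ.1, add_mem (R.root_mem_posCone i) γ.2.1, R.root_add_ne_zero i γ.2.1⟩

/-- Bracketing with a generator adds a simple root to the weight, which stays in `Q⁺` and stays
nonzero because the height grows. -/
lemma IsRealForm.nPos_le (hHr : R.IsRealForm Hr) :
    R.nPos.toSubmodule ≤ ⨆ γ : R.PosIndex, R.rootSpace Hr γ.1 := by
  refine lieSpan_le_of_lie_mem (fun x hx => ?_) fun x hx y hy => ?_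
  · obtain ⟨i, hi⟩ := hHr.posGen_mem hx
    exact Submodule.mem_iSup_of_mem (p := fun γ : R.PosIndex => R.rootSpace Hr γ.1)
      ⟨R.root i, R.root_mem_posCone i, R.root_ne_zero i⟩ hi
  · obtain ⟨i, hi⟩ := hHr.posGen_mem hx
    induction hy using Submodule.iSup_induction' with
    | mem γ y hy =>
      exact Submodule.mem_iSup_of_mem (p := fun γ : R.PosIndex => R.rootSpace Hr γ.1)
        (PosIndex.rootAdd R i γ) (hHr.lie_mem_rootSpace hi hy)
    | zero => rw [lie_zero]; exact zero_mem _
    | add y z _ _ ihy ihz => rw [lie_add]; exact add_mem ihy ihz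

lemma IsRealForm.nNeg_le (hHr : R.IsRealForm Hr) :
    R.nNeg.toSubmodule ≤ ⨆ γ : R.PosIndex, R.rootSpace Hr (-γ.1) := by
  refine lieSpan_le_of_lie_mem (fun x hx => ?_) fun x hx y hy => ?_
  · obtain ⟨i, hi⟩ := hHr.negGen_mem hx
    exact Submodule.mem_iSup_of_mem (p := fun γ : R.PosIndex => R.rootSpace Hr (-γ.1))
      ⟨R.root i, R.root_mem_posCone i, R.root_ne_zero i⟩ hi
  · obtain ⟨i, hi⟩ := hHr.negGen_mem hx
    induction hy using Submodule.iSup_induction' with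
    | mem γ y hy =>
      refine Submodule.mem_iSup_of_mem (p := fun γ : R.PosIndex => R.rootSpace Hr (-γ.1))
        (PosIndex.rootAdd R i γ) ?_
      have h := hHr.lie_mem_rootSpace hi hy
      rwa [← neg_add] at h
    | zero => rw [lie_zero]; exact zero_mem _
    | add y z _ _ ihy ihz => rw [lie_add]; exact add_mem ihy ihz

lemma IsRealForm.subK_le (hHr : R.IsRealForm Hr) : R.subK.toSubmodule ≤ R.rootSpace Hr 0 :=
  fun x hx => hHr.mem_rootSpace.2 fun t => by
    rw [LinearMap.zero_apply, zero_smul]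
    exact R.lie_subK (R.h_mem_subK t) hx

lemma IsRealForm.rootSpace_zero (hHr : R.IsRealForm Hr) :
    R.rootSpace Hr 0 = R.subK.toSubmodule := by
  refine le_antisymm ?_ hHr.subK_le
  obtain ⟨t, ht⟩ := R.exists_root_eq 1
  refine (hHr.rootSpace_le_eigenspace 0 t).trans ?_
  have h := (R.isPrincipal ht).eigenspace_eq 0
  rw [Int.cast_zero] at h
  exact h.le

/-- At the grading element `γ` takes a positive integer value, and the eigenspace of that value
consists of brackets of the `e_i` and `J e_i`. -/
lemma IsRealForm.rootSpace_le_nPos (hHr : R.IsRealForm Hr) {γ : Module.Dual ℂ H}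
    (hγ : γ ∈ R.posCone) (h0 : γ ≠ 0) : R.rootSpace Hr γ ≤ R.nPos.toSubmodule := by
  obtain ⟨t, ht⟩ := R.exists_root_eq 1
  obtain ⟨k, hk⟩ := R.exists_height_succ ht hγ h0
  refine (hHr.rootSpace_le_eigenspace γ t).trans ?_
  have h := (R.isPrincipal ht).eigenspace_eq (Int.ofNat (k + 1))
  rw [hk, show (k + 1 : ℂ) = ((Int.ofNat (k + 1) : ℤ) : ℂ) by simp, h]
  exact bracketPower_le_lieSpan _ k

lemma IsRealForm.rootSpace_neg_le_nNeg (hHr : R.IsRealForm Hr) {γ : Module.Dual ℂ H}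
    (hγ : γ ∈ R.posCone) (h0 : γ ≠ 0) : R.rootSpace Hr (-γ) ≤ R.nNeg.toSubmodule := by
  obtain ⟨t, ht⟩ := R.exists_root_eq 1
  obtain ⟨k, hk⟩ := R.exists_height_succ ht hγ h0
  refine (hHr.rootSpace_le_eigenspace (-γ) t).trans ?_
  have h := (R.isPrincipal ht).eigenspace_eq (Int.negSucc k)
  rw [LinearMap.neg_apply, hk, show (-(k + 1) : ℂ) = ((Int.negSucc k : ℤ) : ℂ) by
    rw [Int.cast_negSucc]; push_cast; rfl, h]
  exact bracketPower_le_lieSpan _ k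

lemma IsRealForm.finiteDimensional_rootSpace (hHr : R.IsRealForm Hr) (γ : Module.Dual ℂ H) :
    FiniteDimensional ℂ (R.rootSpace Hr γ) := by
  obtain ⟨t, ht⟩ := R.exists_root_eq 1
  have := (R.isPrincipal ht).finiteDimensional_eigenspace R.posGen_finite R.negGen_finite
    R.finite_subK (γ t)
  exact Submodule.finiteDimensional_of_le (hHr.rootSpace_le_eigenspace γ t)

lemma IsRealForm.isInternal_rootFamily (hHr : R.IsRealForm Hr) :
    DirectSum.IsInternal (R.rootFamily Hr) := by
  refine DirectSum.isInternal_submodule_of_iSupIndep_of_iSup_eq_top ?_ ?_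
  · rw [rootFamily_eq]
    exact hHr.iSupIndep_rootSpace.comp R.familyWeight_injective
  · obtain ⟨t, ht⟩ := R.exists_root_eq 1
    rw [← top_le_iff, ← (R.isPrincipal ht).span]
    refine sup_le (sup_le (hHr.nNeg_le.trans ?_) (hHr.subK_le.trans ?_)) (hHr.nPos_le.trans ?_)
    · exact iSup_le fun γ => le_iSup (R.rootFamily Hr) (.inl γ)
    · exact le_iSup (R.rootFamily Hr) (.inr (.inl ()))
    · exact iSup_le fun γ => le_iSup (R.rootFamily Hr) (.inr (.inr γ))

lemma realCartan_subset_subK {x : R.Universal} (hx : x ∈ R.realCartan Hr) : x ∈ R.subK := by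
  obtain ⟨t, -, rfl⟩ := hx
  exact R.h_mem_subK t

lemma IsRealForm.root_smul (hHr : R.IsRealForm Hr) {t : H} (ht : t ∈ Hr) (i : Fin n)
    (x : R.Universal) : R.root i t • x = (R.root i t).re • x := by
  have h : R.root i t = ((R.root i t).re : ℂ) := Complex.ext rfl (hHr.root_real i t ht)
  conv_lhs => rw [h]
  rfl

/-- The real form of `g̃₀(A)` meets `K` in `H_r`. -/
lemma IsRealForm.mem_realCartan (hHr : R.IsRealForm Hr) {x : R.Universal}
    (hx : x ∈ R.realPart Hr) (hK : x ∈ R.subK) : x ∈ R.realCartan Hr := by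
  -- The triangular spanning argument works over `ℝ` because the roots are real on `H_r` and the
  -- coroots lie in `H_r`.
  have hle : (R.realPart Hr).toSubmodule ≤
      (LieSubalgebra.lieSpan ℝ R.Universal (Set.range R.f)).toSubmodule ⊔ R.realCartan Hr ⊔
        (LieSubalgebra.lieSpan ℝ R.Universal (Set.range R.e)).toSubmodule := by
    refine lieSpan_le_triangular ?_ ?_ ?_ ?_
    · rintro _ ⟨t, ht, rfl⟩ _ ⟨i, rfl⟩
      change ⁅R.h t, R.e i⁆ ∈ _
      rw [lie_h_e, hHr.root_smul ht]
      exact LieSubalgebra.smul_mem _ _ (LieSubalgebra.subset_lieSpan ⟨i, rfl⟩)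
    · rintro _ ⟨t, ht, rfl⟩ _ ⟨i, rfl⟩
      change ⁅R.h t, R.f i⁆ ∈ _
      rw [lie_h_f, hHr.root_smul ht]
      exact neg_mem (LieSubalgebra.smul_mem _ _ (LieSubalgebra.subset_lieSpan ⟨i, rfl⟩))
    · intro k hk k' hk'
      rw [R.lie_subK (realCartan_subset_subK hk) (realCartan_subset_subK hk')]
      exact zero_mem _
    · rintro _ ⟨i, rfl⟩ _ ⟨j, rfl⟩
      rw [lie_e_f]
      split_ifs
      · exact ⟨_, hHr.coroot_mem i, rfl⟩
      · exact zero_mem _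
  have hNeg : LieSubalgebra.lieSpan ℝ R.Universal (Set.range R.f) ≤ R.realSubalgebra R.nNeg :=
    LieSubalgebra.lieSpan_le.2 (by rintro _ ⟨i, rfl⟩; exact R.f_mem_nNeg i)
  have hPos : LieSubalgebra.lieSpan ℝ R.Universal (Set.range R.e) ≤ R.realSubalgebra R.nPos :=
    LieSubalgebra.lieSpan_le.2 (by rintro _ ⟨i, rfl⟩; exact R.e_mem_nPos i)
  obtain ⟨y, hy, c, hc, rfl⟩ := Submodule.mem_sup.1 (hle hx)
  obtain ⟨a, ha, k, hk, rfl⟩ := Submodule.mem_sup.1 hy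
  obtain ⟨t, ht⟩ := R.exists_root_eq 1
  -- The sum `a + c` lies in `Ñ⁻ + Ñ⁺`, and also in `K` since the whole element and `k` do;
  -- directness makes it zero.
  have hac : a + c ∈ R.nNeg.toSubmodule ⊔ R.nPos.toSubmodule :=
    add_mem (Submodule.mem_sup_left (hNeg ha)) (Submodule.mem_sup_right (hPos hc))
  have hac' : a + c ∈ R.subK.toSubmodule := by
    have := sub_mem hK (realCartan_subset_subK hk)
    rwa [show a + k + c - k = a + c by abel] at this
  have h0 := Submodule.disjoint_def.1 (R.isPrincipal ht).disjoint_zero _ hac' hac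
  rwa [show a + k + c = (a + c) + k by abel, h0, zero_add]

variable (R Hr) in
/-- The image of `H_r` as a real Lie subalgebra. -/
def realCartanSubalgebra : LieSubalgebra ℝ R.Universal where
  toSubmodule := R.realCartan Hr
  lie_mem' := fun {x y} hx hy => by
    rw [R.lie_subK (realCartan_subset_subK hx) (realCartan_subset_subK hy)]
    exact zero_mem (R.realCartan Hr)

lemma IsRealForm.maximal_realCartan (hHr : R.IsRealForm Hr) :
    Maximal (fun L : LieSubalgebra ℝ R.Universal =>
      L ≤ R.realPart Hr ∧ ∀ x ∈ L, ∀ y ∈ L, ⁅x, y⁆ = 0) (R.realCartanSubalgebra Hr) := by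
  refine ⟨⟨fun x hx => LieSubalgebra.subset_lieSpan (Or.inr hx), fun x hx y hy =>
    R.lie_subK (realCartan_subset_subK hx) (realCartan_subset_subK hy)⟩, ?_⟩
  rintro L ⟨hL, hcomm⟩ hle y hy
  refine hHr.mem_realCartan (hL hy) ?_
  -- Commuting with `H_r` means having weight 0, and the weight space of 0 is `K`.
  rw [← LieSubalgebra.mem_toSubmodule, ← hHr.rootSpace_zero]
  intro t ht
  rw [LinearMap.zero_apply, zero_smul]
  exact hcomm _ (hle ⟨t, ht, rfl⟩) _ hy

end RealForm

end Realization

end KacMoodyQuaternion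

end

open KacMoodyQuaternion in
theorem theorem2p2 {n : ℕ} {A : Matrix (Fin n) (Fin n) ℤ} (hA : IsGeneralizedCartan A)
    {H : Type*} [AddCommGroup H] [Module ℂ H] (R : Realization A H) :
    -- generation, as a real Lie algebra
    LieSubalgebra.lieSpan ℝ R.Universal
      (Set.range R.e ∪ (Set.range fun i => R.J (R.e i)) ∪
        Set.range R.f ∪ (Set.range fun i => R.J (R.f i)) ∪
        (R.cartan : Set R.Universal) ∪ (R.cartanJ : Set R.Universal)) = ⊤ ∧
    -- commutation relations
    (∀ (t : H) (i : Fin n),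
      ⁅R.h t, R.e i⁆ = R.root i t • R.e i ∧
      ⁅R.J (R.h t), R.e i⁆ = R.J (R.root i t • R.e i) ∧
      ⁅R.h t, R.J (R.e i)⁆ = R.root i t • R.J (R.e i) ∧
      ⁅R.J (R.h t), R.J (R.e i)⁆ = -(R.root i t • R.e i) ∧
      ⁅R.h t, R.f i⁆ = -(R.root i t • R.f i) ∧
      ⁅R.J (R.h t), R.f i⁆ = -R.J (R.root i t • R.f i) ∧
      ⁅R.h t, R.J (R.f i)⁆ = -(R.root i t • R.J (R.f i)) ∧
      ⁅R.J (R.h t), R.J (R.f i)⁆ = R.root i t • R.f i) ∧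
    (∀ i j : Fin n,
      ⁅R.e i, R.f j⁆ = (if i = j then R.h (R.coroot i) else 0) ∧
      ⁅R.J (R.e i), R.f j⁆ = (if i = j then R.J (R.h (R.coroot i)) else 0) ∧
      ⁅R.e i, R.J (R.f j)⁆ = (if i = j then R.J (R.h (R.coroot i)) else 0) ∧
      ⁅R.J (R.e i), R.J (R.f j)⁆ = -(if i = j then R.h (R.coroot i) else 0)) ∧
    (∀ t t' : H,
      ⁅R.h t, R.h t'⁆ = 0 ∧ ⁅R.h t, R.J (R.h t')⁆ = 0 ∧ ⁅R.J (R.h t), R.J (R.h t')⁆ = 0) ∧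
    -- their special cases for the coroots
    (∀ i j : Fin n,
      ⁅R.h (R.coroot i), R.e j⁆ = (A i j : ℂ) • R.e j ∧
      ⁅R.J (R.h (R.coroot i)), R.e j⁆ = (A i j : ℂ) • R.J (R.e j) ∧
      ⁅R.h (R.coroot i), R.J (R.e j)⁆ = (A i j : ℂ) • R.J (R.e j) ∧
      ⁅R.J (R.h (R.coroot i)), R.J (R.e j)⁆ = -((A i j : ℂ) • R.e j) ∧
      ⁅R.h (R.coroot i), R.f j⁆ = -((A i j : ℂ) • R.f j) ∧
      ⁅R.J (R.h (R.coroot i)), R.f j⁆ = -((A i j : ℂ) • R.J (R.f j)) ∧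
      ⁅R.h (R.coroot i), R.J (R.f j)⁆ = -((A i j : ℂ) • R.J (R.f j)) ∧
      ⁅R.J (R.h (R.coroot i)), R.J (R.f j)⁆ = (A i j : ℂ) • R.f j) ∧
    -- `K = H ⊕ JH`, with `H` and `JH` embedded
    (Function.Injective R.h ∧ Function.Injective (fun t => R.J (R.h t)) ∧
      Disjoint R.cartan R.cartanJ ∧ R.subK.toSubmodule = R.cartan ⊔ R.cartanJ) ∧
    -- triangular decomposition
    DirectSum.IsInternal
      ![R.nNeg.toSubmodule, R.subK.toSubmodule, R.nPos.toSubmodule] ∧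
    -- `K` is a maximal commutative subalgebra of `g̃(A)`
    (∃ L : LieSubalgebra ℝ R.Universal, (L : Set R.Universal) = R.subK ∧
      Maximal (fun L : LieSubalgebra ℝ R.Universal => ∀ x ∈ L, ∀ y ∈ L, ⁅x, y⁆ = 0) L) ∧
    -- root space decomposition
    (∀ Hr : Submodule ℝ H, R.IsRealForm Hr →
      -- `H_r` is a maximal commutative subalgebra of the real form `g̃_r(A)`
      (∃ L : LieSubalgebra ℝ R.Universal, L.toSubmodule = R.realCartan Hr ∧
        Maximal (fun L : LieSubalgebra ℝ R.Universal =>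
          L ≤ R.realPart Hr ∧ ∀ x ∈ L, ∀ y ∈ L, ⁅x, y⁆ = 0) L) ∧
      DirectSum.IsInternal (R.rootFamily Hr) ∧
      R.rootSpace Hr 0 = R.subK.toSubmodule ∧
      (R.realCartan Hr : Set R.Universal) ⊆ R.rootSpace Hr 0 ∧
      (∀ γ : Module.Dual ℂ H, FiniteDimensional ℂ (R.rootSpace Hr γ)) ∧
      (∀ γ ∈ R.posCone, γ ≠ 0 →
        R.rootSpace Hr γ ≤ R.nPos.toSubmodule ∧
        R.rootSpace Hr (-γ) ≤ R.nNeg.toSubmodule)) := by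
  obtain ⟨t, ht⟩ := R.exists_root_eq 1
  refine ⟨R.lieSpan_real_eq_top, R.relations_h, R.relations_e_f, R.relations_h_h, fun i j => ?_,
    ⟨R.h_injective, R.J_injective.comp R.h_injective, R.disjoint_cartan_cartanJ, R.subK_eq⟩,
    (R.isPrincipal ht).isInternal, ⟨R.realSubalgebra R.subK, rfl, R.maximal_subK⟩,
    fun Hr hHr => ⟨⟨R.realCartanSubalgebra Hr, rfl, hHr.maximal_realCartan⟩,
      hHr.isInternal_rootFamily, hHr.rootSpace_zero, fun x hx => ?_,
      hHr.finiteDimensional_rootSpace, fun γ hγ h0 =>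
        ⟨hHr.rootSpace_le_nPos hγ h0, hHr.rootSpace_neg_le_nNeg hγ h0⟩⟩⟩
  · have h := R.relations_h (R.coroot i) j
    simpa only [R.pairing, map_smul] using h
  · exact hHr.subK_le (Realization.realCartan_subset_subK hx)
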